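/- Let $\Omega_0\subset\mathbb{R}^2$ be a non-empty open convex set that contains no line, let $\Omega_1$ be an open convex set with $\operatorname{cl}\Omega_1\subset\Omega_0$, and put $\Omega=\operatorname{cl}(\Omega_0\setminus\Omega_1)$. Suppose that neither $\partial\Omega_0$ nor $\partial\Omega_1$ contains a (non-degenerate) linear segment, that $\Omega_0$ is unbounded, and that every ray contained in $\Omega_0$ has a translate contained in $\Omega_1$. Let $I\subset\mathbb{R}$ be a bounded interval of positive length. For an interval $J$ of positive length write $\langle\varphi\rangle_J=\frac1{|J|}\int_J\varphi$. Let $$\boldsymbol{A}_\Omega=\{\varphi\in L^1(I,\mathbb{R}^2)\mid \varphi(I)\subset\partial\Omega_0,\ \langle\varphi\rangle_J\notin\Omega_1 \text{ for every subinterval } J\subset I \text{ of positive length}\},$$ let $\boldsymbol{A}^{\mathrm b}_\Omega$ be the set of bounded functions in $\boldsymbol{A}_\Omega$, and let $\mu_\varphi$ be the distribution of $\varphi$, i.e. the image of the normalized Lebesgue measure on $I$ under $\varphi$. (1) Let $\{\varphi_k\}_k$ be a finite or infinite sequence of functions in $\boldsymbol{A}_\Omega$ such that $\operatorname{conv}\{\langle\varphi_k\rangle_I\}_k$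 is a bounded subset of $\Omega$, and let $\alpha_k\ge 0$ with $\sum_k\alpha_k=1$. Then there exists $\varphi\in\boldsymbol{A}_\Omega$ such that $\mu_\varphi=\sum_k\alpha_k\mu_{\varphi_k}$. (2) If $f\colon\partial\Omega_0\to\mathbb{R}$ is Borel measurable and bounded from below, then the function $$\boldsymbol{B}(x)=\sup\{\langle f(\varphi)\rangle_I\mid \varphi\in\boldsymbol{A}_\Omega,\ \langle\varphi\rangle_I=x\},\qquad x\in\Omega,$$ takes values in $\mathbb{R}\cup\{+\infty\}$ and is locally concave on $\Omega$, i.e. its restriction to every segment contained in $\Omega$ is concave. (3) If $f\colon\partial\Omega_0\to\mathbb{R}$ is Borel measurable and locally bounded from below, then the function $$\boldsymbol{B}^{\mathrm b}(x)=\sup\{\langle f(\varphi)\rangle_I\mid \varphi\in\boldsymbol{A}^{\mathrm b}_\Omega,\ \langle\varphi\rangle_I=x\},\qquad x\in\Omega,$$ takes values in $\mathbb{R}\cup\{+\infty\}$ and is locally concave on $\Omega$. In (2) and (3) the averages $\langle f(\varphi)\rangle_I$ are well defined in $(-\infty,+\infty]$. -/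

import Mathlib

open Set MeasureTheory Topology

namespace Bellman

/-- The Euclidean plane. -/
abbrev Plane : Type := EuclideanSpace ℝ (Fin 2)

/-- The standing assumptions on the pair of convex sets: `Ω₀` is a non-empty open convex set that
contains no line, `Ω₁` is an open convex set whose closure lies in `Ω₀`. -/
structure IsPair (Ω₀ Ω₁ : Set Plane) : Prop where
  nonempty : Ω₀.Nonempty
  isOpen_outer : IsOpen Ω₀
  convex_outer : Convex ℝ Ω₀
  no_line : ¬ ∃ x v : Plane, v ≠ 0 ∧ ∀ t : ℝ, x + t • v ∈ Ω₀
  isOpen_inner : IsOpen Ω₁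
  convex_inner : Convex ℝ Ω₁
  closure_subset : closure Ω₁ ⊆ Ω₀

/-- The domain `Ω = cl (Ω₀ \ Ω₁)`. -/
def domain (Ω₀ Ω₁ : Set Plane) : Set Plane := closure (Ω₀ \ Ω₁)

/-- The set contains no non-degenerate linear segment. -/
def NoSegments (S : Set Plane) : Prop :=
  ∀ x y : Plane, x ≠ y → ¬ segment ℝ x y ⊆ S

/-- `Ω₀` is unbounded and every ray inside it has a translate that lies in `Ω₁` entirely. -/
def RayCondition (Ω₀ Ω₁ : Set Plane) : Prop :=
  ¬ Bornology.IsBounded Ω₀ ∧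
    ∀ x v : Plane, v ≠ 0 → (∀ t : ℝ, 0 ≤ t → x + t • v ∈ Ω₀) →
      ∃ w : Plane, ∀ t : ℝ, 0 ≤ t → w + (x + t • v) ∈ Ω₁

/-- A bounded interval of positive length (open, closed or half-open). -/
structure IsInterval (J : Set ℝ) : Prop where
  ordConnected : J.OrdConnected
  bounded : Bornology.IsBounded J
  nontrivial : J.Nontrivial

/-- The class `A_Ω` on the interval `I`: summable functions with values in `∂Ω₀` none of whose
averages over a subinterval lies in `Ω₁`. Functions on `I` are represented by functions on `ℝ`;
only the values on `I` matter. -/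
structure MemA (Ω₀ Ω₁ : Set Plane) (I : Set ℝ) (φ : ℝ → Plane) : Prop where
  integrable : IntegrableOn φ I
  mem_frontier : ∀ t ∈ I, φ t ∈ frontier Ω₀
  average_notMem : ∀ J : Set ℝ, IsInterval J → J ⊆ I → (⨍ t in J, φ t) ∉ Ω₁

/-- The class of bounded functions in `A_Ω`. -/
def MemAb (Ω₀ Ω₁ : Set Plane) (I : Set ℝ) (φ : ℝ → Plane) : Prop :=
  MemA Ω₀ Ω₁ I φ ∧ Bornology.IsBounded (φ '' I)

/-- The distribution of `φ`: the image of the normalized Lebesgue measure on `I` under `φ`. -/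
noncomputable def distribution (I : Set ℝ) (φ : ℝ → Plane) : Measure Plane :=
  Measure.map φ (ProbabilityTheory.cond volume I)

/-- The average over `I` of a function whose negative part is summable, as an element of
`(-∞, +∞]`: the average of the positive part minus the average of the negative part. -/
noncomputable def extAverage (I : Set ℝ) (g : ℝ → ℝ) : EReal :=
  ((∫⁻ t, ENNReal.ofReal (g t) ∂(ProbabilityTheory.cond volume I) : ENNReal) : EReal) -
    ((∫⁻ t, ENNReal.ofReal (-g t) ∂(ProbabilityTheory.cond volume I) : ENNReal) : EReal)

/-- The Bellman function: the supremum of the averages of `f(φ)` over all `φ ∈ A_Ω` with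
average `x`. -/
noncomputable def bellman (Ω₀ Ω₁ : Set Plane) (I : Set ℝ) (f : Plane → ℝ) (x : Plane) : EReal :=
  sSup {s : EReal | ∃ φ : ℝ → Plane, MemA Ω₀ Ω₁ I φ ∧ (⨍ t in I, φ t) = x ∧
    s = extAverage I (fun t => f (φ t))}

/-- The same supremum over the bounded functions of the class. -/
noncomputable def bellmanB (Ω₀ Ω₁ : Set Plane) (I : Set ℝ) (f : Plane → ℝ) (x : Plane) : EReal :=
  sSup {s : EReal | ∃ φ : ℝ → Plane, MemAb Ω₀ Ω₁ I φ ∧ (⨍ t in I, φ t) = x ∧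
    s = extAverage I (fun t => f (φ t))}

/-- `G` takes values in `ℝ ∪ {+∞}` on `w` and is concave on every segment contained in `w`. -/
def LocallyConcave (w : Set Plane) (G : Plane → EReal) : Prop :=
  (∀ x ∈ w, G x ≠ ⊥) ∧
    ∀ x y : Plane, segment ℝ x y ⊆ w → ∀ a b : ℝ, 0 ≤ a → 0 ≤ b → a + b = 1 →
      (a : EReal) * G x + (b : EReal) * G y ≤ G (a • x + b • y)

/-- `f` is locally bounded from below on `S`. -/
def LocallyBddBelowOn (S : Set Plane) (f : Plane → ℝ) : Prop :=
  ∀ x ∈ S, ∃ U ∈ 𝓝[S] x, BddBelow (f '' U)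

end Bellman

/-! For (1) the function is the monotone rearrangement of the mixture `μ = ∑ α_k μ_{φ_k}`. Since
`Ω₀` is unbounded, it has a recession direction `e`, called vertical; by the ray condition `e` is a
recession direction of `Ω₁` too. As `∂Ω₀` has no segments, a linear functional `X` with kernel
spanned by `e` is injective on `∂Ω₀`. So `∂Ω₀` is ordered by `X`, and composing the quantile
function of `X_* μ` with the inverse of `X` on `∂Ω₀` gives `ψ` with distribution `μ` and `X ∘ ψ`
monotone almost everywhere.

That `ψ` lies in `A_Ω` is tested by the functions `wedge X L w`, with `w ∈ Ω₁` and `L e > 0`. They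
are affine except for a truncation by `0` on one side of the vertical line through `w`; the upper
half of that line lies in `Ω₁`, so off `Ω₁` they are locally concave. Two facts collide. Upper
bound: every `φ ∈ A_Ω` satisfies `⟨wedge φ⟩ ≤ wedge ⟨φ⟩`, by a rising sun argument
(`setAverage_wedge_le`). Jensen's inequality for averages in a convex set missing `Ω₁`
(`tsum_wedge_nonpos`) then gives `∫ wedge dμ ≤ 0`, provided the mean of `μ` is not to the right of
`w`. Lower bound: if an average `A` of `ψ` over `J` were in `Ω₁`, take `w ∈ Ω₁` slightly below `A`
and the line through `w` and the left end of the arc `ψ(J)`. Convexity fixes the sign pattern of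
`L(· - w)` along `∂Ω₀`, and monotonicity yields `wedge(ψ) ≥ 1_J L(ψ - w)`, with positive integral
(`exists_integral_wedge_pos`). If the mean is to the right of `w`, replace `X` by `-X`.

For (2) and (3), a mixture of two competitors along a segment in `Ω` is again a competitor by (1),
and averages of `f` are linear in the distribution, so the supremum is concave there. Competitors
exist at every point of `Ω`, because it is either on `∂Ω₀` or on a chord of `Ω₀` missing `Ω₁`
(`exists_chord`). -/

namespace Bellman

/-! ### The rising sun lemma -/

/-- The integral over a bounded open set is nonpositive if the integrals over its component
intervals are. -/
theorem setIntegral_nonpos_of_components {U : Set ℝ} (hU : IsOpen U) (hb : Bornology.IsBounded U)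
    {g : ℝ → ℝ} (hg : IntegrableOn g U)
    (h : ∀ p q : ℝ, p < q → p ∉ U → q ∉ U → Ioo p q ⊆ U → ∫ t in Ioo p q, g t ≤ 0) :
    ∫ t in U, g t ≤ 0 := by
  set K : Set (ℝ × ℝ) := {r | r.1 < r.2 ∧ r.1 ∉ U ∧ r.2 ∉ U ∧ Ioo r.1 r.2 ⊆ U} with hK
  have hdisj : K.PairwiseDisjoint fun r => Ioo r.1 r.2 := by
    rintro ⟨p, q⟩ ⟨_, hp, hq, hs⟩ ⟨p', q'⟩ ⟨_, hp', hq', hs'⟩ hne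
    refine Set.disjoint_left.2 fun t ht ht' => hne ?_
    simp only [mem_Ioo] at ht ht' hp hq hp' hq' hs hs'
    have e1 : p = p' := by
      rcases lt_trichotomy p p' with h1 | h1 | h1
      · exact absurd (hs ⟨h1, ht'.1.trans ht.2⟩) hp'
      · exact h1
      · exact absurd (hs' ⟨h1, ht.1.trans ht'.2⟩) hp
    have e2 : q = q' := by
      rcases lt_trichotomy q q' with h1 | h1 | h1
      · exact absurd (hs' ⟨ht'.1.trans ht.2, h1⟩) hq
      · exact h1
      · exact absurd (hs ⟨ht.1.trans ht'.2, h1⟩) hq'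
    rw [e1, e2]
  have hcount : K.Countable :=
    hdisj.countable_of_isOpen (fun r _ => isOpen_Ioo) (fun r hr => nonempty_Ioo.2 hr.1)
  have hUeq : U = ⋃ r : K, Ioo r.1.1 r.1.2 := by
    refine Subset.antisymm (fun x hx => ?_) (iUnion_subset fun r => r.2.2.2.2)
    obtain ⟨R, hR⟩ := hb.subset_closedBall 0
    have hbd : ∀ y ∈ U, |y| ≤ R := fun y hy => by simpa using hR hy
    set A := Uᶜ ∩ Iic x
    set B := Uᶜ ∩ Ici x
    have hA : IsClosed A := hU.isClosed_compl.inter isClosed_Iic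
    have hB : IsClosed B := hU.isClosed_compl.inter isClosed_Ici
    have hx' := abs_le.1 (hbd x hx)
    have hAn : A.Nonempty := ⟨-R - 1, fun h => by
      have := (abs_le.1 (hbd _ h)).1; linarith, by simp only [mem_Iic]; linarith⟩
    have hBn : B.Nonempty := ⟨R + 1, fun h => by
      have := (abs_le.1 (hbd _ h)).2; linarith, by simp only [mem_Ici]; linarith⟩
    have hAb : BddAbove A := ⟨x, fun y hy => hy.2⟩
    have hBb : BddBelow B := ⟨x, fun y hy => hy.2⟩
    have hAm := hA.csSup_mem hAn hAb
    have hBm := hB.csInf_mem hBn hBb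
    have hlt1 : sSup A < x := lt_of_le_of_ne hAm.2 fun h => hAm.1 (h ▸ hx)
    have hlt2 : x < sInf B := lt_of_le_of_ne hBm.2 fun h => hBm.1 (h ▸ hx)
    refine mem_iUnion.2 ⟨⟨(sSup A, sInf B), hlt1.trans hlt2, hAm.1, hBm.1, ?_⟩, hlt1, hlt2⟩
    rintro y ⟨h1, h2⟩
    by_contra hy
    rcases le_total y x with h3 | h3
    · exact absurd (le_csSup hAb ⟨hy, h3⟩) (not_le.2 h1)
    · exact absurd (csInf_le hBb ⟨hy, h3⟩) (not_le.2 h2)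
  have : Countable K := hcount
  rw [hUeq, integral_iUnion (fun r : K => measurableSet_Ioo)
    (fun (r s : K) hrs => hdisj r.2 s.2 fun h => hrs (Subtype.ext h)) (hUeq ▸ hg)]
  exact tsum_nonpos fun r => h _ _ r.2.1 r.2.2.1 r.2.2.2.1 r.2.2.2.2

theorem setIntegral_Ioo_eq_sub {f : ℝ → ℝ} (hf : Integrable f) (c : ℝ) {p q : ℝ} (h : p ≤ q) :
    ∫ t in Ioo p q, f t = (∫ t in c..q, f t) - ∫ t in c..p, f t := by
  rw [intervalIntegral.integral_interval_sub_left hf.intervalIntegrable hf.intervalIntegrable,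
    intervalIntegral.integral_of_le h, integral_Ioc_eq_integral_Ioo]

/-- A form of the rising sun lemma: if `∫ f ≤ 0`, if `g` is nonpositive wherever `f` is, and if
the integral of `g` is nonpositive over every interval on which the integral of `f` vanishes, then
`∫ g ≤ 0`. -/
theorem rising_sun_of_integrable {a b : ℝ} (hab : a < b) {f g : ℝ → ℝ} (hf : Integrable f)
    (hg : Integrable g) (h0 : ∫ t in Ioo a b, f t ≤ 0)
    (hfg : ∀ t ∈ Ioo a b, f t ≤ 0 → g t ≤ 0)
    (hI : ∀ p q : ℝ, a ≤ p → p < q → q ≤ b → ∫ t in Ioo p q, f t = 0 →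
      ∫ t in Ioo p q, g t ≤ 0) :
    ∫ t in Ioo a b, g t ≤ 0 := by
  set H : ℝ → ℝ := fun x => ∫ t in a..x, f t with hH
  have Hc : Continuous H := intervalIntegral.continuous_primitive
    (fun _ _ => hf.intervalIntegrable) a
  have Ha : H a = 0 := intervalIntegral.integral_same
  have Hb : H b ≤ 0 := by
    have := setIntegral_Ioo_eq_sub hf a hab.le
    simp only [intervalIntegral.integral_same, sub_zero] at this
    linarith [show H b = ∫ t in a..b, f t from rfl]
  have hI' : ∀ p q : ℝ, a ≤ p → p < q → q ≤ b → H p = H q → ∫ t in Ioo p q, g t ≤ 0 :=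
    fun p q h1 h2 h3 h4 => hI p q h1 h2 h3 (by
      rw [setIntegral_Ioo_eq_sub hf a h2.le]; exact sub_eq_zero.2 h4.symm)
  set Z : Set ℝ := Icc a b ∩ {x | H x = 0}
  have hZ : IsClosed Z := isClosed_Icc.inter (isClosed_eq Hc continuous_const)
  have hZn : Z.Nonempty := ⟨a, left_mem_Icc.2 hab.le, Ha⟩
  have hZb : BddAbove Z := ⟨b, fun y hy => hy.1.2⟩
  -- `z` is the last zero of the primitive `H`. The integral of `f` over `(a, z)` vanishes, so `hI`
  -- settles that piece, and `H < 0` on `(z, b]`.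
  obtain ⟨⟨haz, hzb⟩, Hz⟩ := hZ.csSup_mem hZn hZb
  set z := sSup Z
  have hneg : ∀ x, z < x → x ≤ b → H x < 0 := by
    intro x hx hxb
    by_contra! hc
    obtain ⟨y, hy, hy0⟩ := intermediate_value_Icc' hxb Hc.continuousOn ⟨Hb, hc⟩
    exact absurd (le_csSup hZb ⟨⟨haz.trans (hx.le.trans hy.1), hy.2⟩, hy0⟩)
      (not_le.2 (hx.trans_le hy.1))
  have hleft : ∫ t in Ioo a z, g t ≤ 0 := by
    rcases haz.eq_or_lt with h | h
    · simp [← h]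
    · exact hI' a z le_rfl h hzb (by rw [Ha, Hz])
  have hsplit : ∫ t in Ioo a b, g t = (∫ t in Ioo a z, g t) + ∫ t in Ioo z b, g t := by
    rw [setIntegral_Ioo_eq_sub hg a hab.le, setIntegral_Ioo_eq_sub hg a haz,
      setIntegral_Ioo_eq_sub hg a hzb]
    ring
  rw [hsplit]
  refine add_nonpos hleft ?_
  -- The shadow set: points of `(z, b)` with a strictly higher value of `H` somewhere to the right.
  -- `H` takes equal values at the two ends of each component, so `hI` applies there.
  set U : Set ℝ := ⋃ y : Iic b, Ioo z y ∩ {x | H x < H y} with hUdef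
  have hUo : IsOpen U := isOpen_iUnion fun y =>
    isOpen_Ioo.inter (isOpen_lt Hc continuous_const)
  have memU : ∀ x, x ∈ U ↔ z < x ∧ ∃ y, x < y ∧ y ≤ b ∧ H x < H y := by
    intro x
    simp only [hUdef, mem_iUnion, mem_inter_iff, mem_Ioo, mem_ofPred_eq, Subtype.exists, mem_Iic]
    constructor
    · rintro ⟨y, hy, ⟨h1, h2⟩, h3⟩
      exact ⟨h1, y, h2, hy, h3⟩
    · rintro ⟨h1, y, h2, hy, h3⟩
      exact ⟨y, hy, ⟨h1, h2⟩, h3⟩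
  have hUsub : U ⊆ Ioo z b := fun x hx => by
    obtain ⟨h1, y, h2, h3, -⟩ := (memU x).1 hx
    exact ⟨h1, h2.trans_le h3⟩
  have hUint : ∫ t in U, g t ≤ 0 := by
    refine setIntegral_nonpos_of_components hUo (Metric.isBounded_Ioo z b |>.subset hUsub)
      hg.integrableOn fun p q hpq hp hq hs => ?_
    have hzp : z ≤ p := by
      by_contra! hc
      obtain ⟨t, ht1, ht2⟩ := exists_between (lt_min hc hpq)
      exact absurd (hUsub (hs ⟨ht1, ht2.trans_le (min_le_right _ _)⟩)).1
        (not_lt.2 (ht2.le.trans (min_le_left _ _)))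
    have hqb : q ≤ b := by
      by_contra! hc
      obtain ⟨t, ht1, ht2⟩ := exists_between (max_lt hc hpq)
      exact absurd (hUsub (hs ⟨(le_max_right _ _).trans_lt ht1, ht2⟩)).2
        (not_lt.2 ((le_max_left _ _).trans ht1.le))
    have hle : ∀ x ∈ Ioo p q, H x ≤ H q := by
      rintro x ⟨hx1, hx2⟩
      obtain ⟨y, hy, hmax⟩ := isCompact_Icc.exists_isMaxOn
        (nonempty_Icc.2 (hx2.le.trans hqb)) Hc.continuousOn
      have hxy : H x ≤ H y := hmax (left_mem_Icc.2 (hx2.le.trans hqb))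
      rcases lt_or_ge y q with h1 | h1
      · obtain ⟨-, y', h2, h3, h4⟩ := (memU y).1 (hs ⟨hx1.trans_le hy.1, h1⟩)
        exact absurd (hmax (show y' ∈ Icc x b from ⟨hy.1.trans h2.le, h3⟩)) (not_le.2 h4)
      · rcases h1.eq_or_lt with h2 | h2
        · rwa [← h2] at hxy
        · refine hxy.trans (not_lt.1 fun h3 => hq ((memU q).2
            ⟨hzp.trans_lt hpq, y, h2, hy.2, h3⟩))
    have hpq' : H p ≤ H q := by
      have : Icc p q ⊆ {x | H x ≤ H q} := by
        rw [← closure_Ioo hpq.ne]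
        exact closure_minimal hle (isClosed_le Hc continuous_const)
      exact this (left_mem_Icc.2 hpq.le)
    -- No component starts at `z`: this would give `0 = H z ≤ H q < 0`.
    rcases hzp.eq_or_lt with h1 | h1
    · have := hneg q (h1 ▸ hpq) hqb
      have h2 : H p = 0 := by rw [← h1]; exact Hz
      linarith
    · exact hI' p q (haz.trans hzp) hpq hqb
        (le_antisymm hpq' (not_lt.1 fun h3 => hp ((memU p).2 ⟨h1, q, hpq, hqb, h3⟩)))
  -- Outside the shadow all right difference quotients of `H` are nonpositive, so `f ≤ 0` almost
  -- everywhere by Lebesgue differentiation.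
  have hrest : ∫ t in Ioo z b \ U, g t ≤ 0 := by
    refine setIntegral_nonpos_ae (measurableSet_Ioo.diff hUo.measurableSet) ?_
    have hd := (hf.intervalIntegrable (a := a) (b := b)).ae_hasDerivAt_integral
    rw [uIcc_of_le hab.le] at hd
    filter_upwards [hd] with x hx hxU
    have hxI : x ∈ Ioo a b := ⟨haz.trans_lt hxU.1.1, hxU.1.2⟩
    have hder := hx ⟨hxI.1.le, hxI.2.le⟩ a (left_mem_Icc.2 hab.le)
    refine hfg x hxI ?_
    have ht := (hasDerivWithinAt_iff_tendsto_slope' (notMem_Ioi.2 le_rfl)).1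
      (hder.hasDerivWithinAt (s := Ioi x))
    refine le_of_tendsto ht ?_
    filter_upwards [Ioo_mem_nhdsGT hxI.2] with y hy
    rw [slope_def_field]
    refine div_nonpos_of_nonpos_of_nonneg (sub_nonpos.2 ?_) (sub_nonneg.2 hy.1.le)
    exact not_lt.1 fun h3 => hxU.2 ((memU x).2 ⟨hxU.1.1, y, hy.1, hy.2.le, h3⟩)
  have : ∫ t in Ioo z b, g t = (∫ t in U, g t) + ∫ t in Ioo z b \ U, g t := by
    rw [← setIntegral_union disjoint_sdiff_right (measurableSet_Ioo.diff hUo.measurableSet)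
      hg.integrableOn hg.integrableOn, union_sdiff_cancel hUsub]
  rw [this]
  exact add_nonpos hUint hrest

theorem rising_sun {a b : ℝ} (hab : a < b) {f g : ℝ → ℝ} (hf : IntegrableOn f (Ioo a b))
    (hg : IntegrableOn g (Ioo a b)) (h0 : ∫ t in Ioo a b, f t ≤ 0)
    (hfg : ∀ t ∈ Ioo a b, f t ≤ 0 → g t ≤ 0)
    (hI : ∀ p q : ℝ, a ≤ p → p < q → q ≤ b → ∫ t in Ioo p q, f t = 0 →
      ∫ t in Ioo p q, g t ≤ 0) :
    ∫ t in Ioo a b, g t ≤ 0 := by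
  have key : ∀ (u : ℝ → ℝ) (p q : ℝ), a ≤ p → q ≤ b →
      ∫ t in Ioo p q, (Ioo a b).indicator u t = ∫ t in Ioo p q, u t := fun u p q hp hq =>
    setIntegral_congr_fun measurableSet_Ioo fun t ht =>
      indicator_of_mem (Ioo_subset_Ioo hp hq ht) u
  rw [← key g a b le_rfl le_rfl]
  refine rising_sun_of_integrable hab (hf.integrable_indicator measurableSet_Ioo)
    (hg.integrable_indicator measurableSet_Ioo) (by rwa [key f a b le_rfl le_rfl])
    (fun t ht => ?_) fun p q hp hpq hq => ?_
  · simpa only [indicator_of_mem ht] using hfg t ht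
  · rw [key f p q hp hq, key g p q hp hq]
    exact hI p q hp hpq hq

/-! ### Quantile functions -/

/-- Every probability measure on the line is the image of the normalized Lebesgue measure on an
interval under a monotone function. -/
theorem exists_quantile (ν : Measure ℝ) [IsProbabilityMeasure ν] {a b : ℝ} (hab : a < b) :
    ∃ Q : ℝ → ℝ, MonotoneOn Q (Ioo a b) ∧ AEMeasurable Q (volume.restrict (Ioo a b)) ∧
      Measure.map Q (ProbabilityTheory.cond volume (Ioo a b)) = ν := by
  have hba : 0 < b - a := sub_pos.2 hab
  set F := ProbabilityTheory.cdf ν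
  set Q : ℝ → ℝ := fun t => sInf {x | (t - a) / (b - a) ≤ F x} with hQ
  -- The Galois connection between the quantile function and the distribution function; right
  -- continuity of `F` gives the forward direction. Monotonicity and the law of `Q` both follow from
  -- it.
  have gal : ∀ t ∈ Ioo a b, ∀ x, Q t ≤ x ↔ (t - a) / (b - a) ≤ F x := by
    intro t ht x
    set s := (t - a) / (b - a)
    have hs0 : 0 < s := div_pos (sub_pos.2 ht.1) hba
    have hs1 : s < 1 := (div_lt_one hba).2 (by linarith [ht.2])
    have hne : {x | s ≤ F x}.Nonempty :=
      ((ProbabilityTheory.tendsto_cdf_atTop ν).eventually_const_le hs1).exists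
    have hbd : BddBelow {x | s ≤ F x} := by
      obtain ⟨y, hy⟩ :=
        ((ProbabilityTheory.tendsto_cdf_atBot ν).eventually (gt_mem_nhds hs0)).exists
      refine ⟨y, fun x hx => ?_⟩
      by_contra! hc
      exact absurd (hx.trans (F.mono hc.le)) (not_le.2 hy)
    refine ⟨fun h => ?_, fun h => csInf_le hbd h⟩
    have hr : Filter.Tendsto F (𝓝[>] x) (𝓝 (F x)) := (F.right_continuous x).tendsto.mono_left
      (nhdsWithin_mono _ Ioi_subset_Ici_self)
    refine ge_of_tendsto hr ?_
    filter_upwards [self_mem_nhdsWithin] with y hy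
    obtain ⟨x', hx', hlt⟩ := (csInf_lt_iff hbd hne).1 (lt_of_le_of_lt h hy)
    exact le_trans hx' (F.mono hlt.le)
  have hmono : MonotoneOn Q (Ioo a b) := by
    intro t ht t' ht' htt
    rw [gal t ht]
    refine le_trans ?_ ((gal t' ht' _).1 le_rfl)
    gcongr
  have hmeas : AEMeasurable Q (volume.restrict (Ioo a b)) :=
    aemeasurable_restrict_of_monotoneOn measurableSet_Ioo hmono
  refine ⟨Q, hmono, hmeas, ?_⟩
  have hvol : volume (Ioo a b) = ENNReal.ofReal (b - a) := Real.volume_Ioo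
  have hprob : IsProbabilityMeasure (ProbabilityTheory.cond volume (Ioo a b)) :=
    ProbabilityTheory.cond_isProbabilityMeasure_of_finite
      (by rw [hvol]; simpa using hab) (by rw [hvol]; exact ENNReal.ofReal_ne_top)
  have hm2 : AEMeasurable Q (ProbabilityTheory.cond volume (Ioo a b)) := hmeas.smul_measure _
  have := Measure.isProbabilityMeasure_map hm2
  refine Measure.ext_of_Iic _ _ fun x => ?_
  rw [Measure.map_apply_of_aemeasurable hm2 measurableSet_Iic,
    ProbabilityTheory.cond_apply measurableSet_Ioo, ← ProbabilityTheory.ofReal_cdf]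
  have hset : (Ioo a b ∩ Q ⁻¹' Iic x : Set ℝ) =ᵐ[volume] Ioc a (a + (b - a) * F x) := by
    have : Ioo a b ∩ Q ⁻¹' Iic x = Ioc a (a + (b - a) * F x) ∩ Iio b := by
      ext t
      simp only [mem_inter_iff, mem_preimage, mem_Iic, mem_Ioc, mem_Iio, mem_Ioo]
      constructor
      · rintro ⟨ht, h⟩
        have := (gal t ht x).1 h
        rw [div_le_iff₀ hba] at this
        exact ⟨⟨ht.1, by linarith⟩, ht.2⟩
      · rintro ⟨⟨h1, h2⟩, h3⟩
        refine ⟨⟨h1, h3⟩, (gal t ⟨h1, h3⟩ x).2 ?_⟩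
        rw [div_le_iff₀ hba]
        linarith
    rw [this]
    have hne : ∀ᵐ t : ℝ, t ≠ b := by simp [ae_iff, measure_singleton]
    filter_upwards [hne] with t ht
    have h1 : F x ≤ 1 := ProbabilityTheory.cdf_le_one ν x
    refine propext ⟨fun h => h.1, fun h => ⟨h, lt_of_le_of_ne (h.2.trans ?_) ht⟩⟩
    nlinarith
  rw [measure_congr hset, hvol, Real.volume_Ioc, ← ENNReal.ofReal_inv_of_pos hba,
    ← ENNReal.ofReal_mul (by positivity)]
  congr 1
  field_simp
  ring

/-! ### Averages over bounded intervals -/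

theorem IsInterval.exists_Ioo {I : Set ℝ} (hI : IsInterval I) :
    ∃ a b : ℝ, a < b ∧ Ioo a b ⊆ I ∧ I ⊆ Icc a b := by
  obtain ⟨x, hx, y, hy, hxy⟩ := hI.nontrivial
  have hba := hI.bounded.bddAbove
  have hbb := hI.bounded.bddBelow
  refine ⟨sInf I, sSup I, ?_, fun t ht => ?_, fun t ht => ⟨csInf_le hbb ht, le_csSup hba ht⟩⟩
  · rcases lt_or_gt_of_ne hxy with h | h
    · exact (csInf_le hbb hx).trans_lt (h.trans_le (le_csSup hba hy))
    · exact (csInf_le hbb hy).trans_lt (h.trans_le (le_csSup hba hx))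
  · obtain ⟨u, hu, hut⟩ := (csInf_lt_iff hbb ⟨x, hx⟩).1 ht.1
    obtain ⟨v, hv, htv⟩ := (lt_csSup_iff hba ⟨x, hx⟩).1 ht.2
    exact hI.ordConnected.out hu hv ⟨hut.le, htv.le⟩

theorem isInterval_Ioo {p q : ℝ} (h : p < q) : IsInterval (Ioo p q) :=
  ⟨ordConnected_Ioo, Metric.isBounded_Ioo p q, by
    obtain ⟨x, hx, hx'⟩ := exists_between h
    obtain ⟨y, hy, hy'⟩ := exists_between hx'
    exact ⟨x, ⟨hx, hx'⟩, y, ⟨hx.trans hy, hy'⟩, hy.ne⟩⟩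

theorem restrict_eq_of_between {I : Set ℝ} {a b : ℝ} (h1 : Ioo a b ⊆ I) (h2 : I ⊆ Icc a b) :
    (volume.restrict I : Measure ℝ) = volume.restrict (Ioo a b) := by
  refine Measure.restrict_congr_set (Filter.EventuallyLE.antisymm ?_ ?_)
  · exact Filter.EventuallyLE.trans (LE.le.eventuallyLE h2) Ioo_ae_eq_Icc.symm.le
  · exact LE.le.eventuallyLE h1

theorem cond_eq_of_between {I : Set ℝ} {a b : ℝ} (h1 : Ioo a b ⊆ I) (h2 : I ⊆ Icc a b) :
    ProbabilityTheory.cond (volume : Measure ℝ) I = ProbabilityTheory.cond volume (Ioo a b) := by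
  have h := restrict_eq_of_between h1 h2
  have h3 : volume I = volume (Ioo a b) := by
    rw [← Measure.restrict_apply_univ, h, Measure.restrict_apply_univ]
  rw [ProbabilityTheory.cond, ProbabilityTheory.cond, h, h3]

theorem setAverage_eq_integral_cond {E : Type*} [NormedAddCommGroup E] [NormedSpace ℝ E]
    (I : Set ℝ) (φ : ℝ → E) :
    ⨍ t in I, φ t = ∫ t, φ t ∂(ProbabilityTheory.cond volume I) := by
  rw [average, Measure.restrict_apply_univ, ProbabilityTheory.cond]

theorem isProbabilityMeasure_cond_Ioo {a b : ℝ} (hab : a < b) :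
    IsProbabilityMeasure (ProbabilityTheory.cond (volume : Measure ℝ) (Ioo a b)) :=
  ProbabilityTheory.cond_isProbabilityMeasure_of_finite
    (by rw [Real.volume_Ioo]; simpa using hab) (by rw [Real.volume_Ioo]; exact ENNReal.ofReal_ne_top)

theorem IsInterval.isProbabilityMeasure_cond {I : Set ℝ} (hI : IsInterval I) :
    IsProbabilityMeasure (ProbabilityTheory.cond (volume : Measure ℝ) I) := by
  obtain ⟨a, b, hab, h1, h2⟩ := hI.exists_Ioo
  rw [cond_eq_of_between h1 h2]
  exact isProbabilityMeasure_cond_Ioo hab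

theorem IntegrableOn.integrable_cond {E : Type*} [NormedAddCommGroup E] {I : Set ℝ}
    (hI : IsInterval I) {φ : ℝ → E} (h : IntegrableOn φ I) :
    Integrable φ (ProbabilityTheory.cond volume I) := by
  obtain ⟨a, b, hab, h1, h2⟩ := hI.exists_Ioo
  rw [cond_eq_of_between h1 h2]
  rw [IntegrableOn, restrict_eq_of_between h1 h2] at h
  refine h.smul_measure ?_
  rw [Real.volume_Ioo]
  simpa using hab

theorem setAverage_eq_of_between {E : Type*} [NormedAddCommGroup E] [NormedSpace ℝ E]
    {I : Set ℝ} {a b : ℝ} (h1 : Ioo a b ⊆ I) (h2 : I ⊆ Icc a b) (φ : ℝ → E) :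
    ⨍ t in I, φ t = ⨍ t in Ioo a b, φ t := by
  rw [setAverage_eq_integral_cond, setAverage_eq_integral_cond, cond_eq_of_between h1 h2]

theorem setAverage_Ioo {E : Type*} [NormedAddCommGroup E] [NormedSpace ℝ E] {a b : ℝ} (h : a < b)
    (φ : ℝ → E) : ⨍ t in Ioo a b, φ t = (b - a)⁻¹ • ∫ t in Ioo a b, φ t := by
  rw [setAverage_eq, Measure.real, Real.volume_Ioo, ENNReal.toReal_ofReal (sub_pos.2 h).le]

theorem setIntegral_Ioo_clm (L : Plane →L[ℝ] ℝ) (w : Plane) {a b : ℝ} (h : a < b) {φ : ℝ → Plane}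
    (hφ : IntegrableOn φ (Ioo a b)) :
    ∫ t in Ioo a b, L (φ t - w) = (b - a) * L ((⨍ t in Ioo a b, φ t) - w) := by
  have hc : IntegrableOn (fun _ : ℝ => w) (Ioo a b) :=
    integrableOn_const (by rw [Real.volume_Ioo]; exact ENNReal.ofReal_ne_top)
  have hi := L.integral_comp_comm (hφ.sub hc)
  simp only [Pi.sub_apply] at hi
  rw [hi, integral_sub hφ hc, setIntegral_const,
    Measure.real, Real.volume_Ioo, ENNReal.toReal_ofReal (sub_pos.2 h).le, setAverage_Ioo h,
    map_sub, map_sub, map_smul, map_smul, smul_eq_mul, smul_eq_mul]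
  have : b - a ≠ 0 := (sub_pos.2 h).ne'
  field_simp

/-! ### The test functions and their Bellman inequality -/

/-- The minimum of `0` and of the affine function `p ↦ L (p - w)` on the half-plane `X p < X w`,
continued by the affine function on the half-plane `X w ≤ X p`. -/
noncomputable def wedge (X L : Plane →L[ℝ] ℝ) (w p : Plane) : ℝ :=
  if X w ≤ X p then L (p - w) else min 0 (L (p - w))

theorem measurable_wedge (X L : Plane →L[ℝ] ℝ) (w : Plane) : Measurable (wedge X L w) := by
  have h : Measurable fun p => L (p - w) := by fun_prop
  exact Measurable.ite (measurableSet_le measurable_const (by fun_prop)) h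
    (measurable_const.min h)

theorem wedge_le (X L : Plane →L[ℝ] ℝ) (w p : Plane) : wedge X L w p ≤ L (p - w) := by
  unfold wedge
  split_ifs
  · exact le_rfl
  · exact min_le_right _ _

theorem wedge_nonpos {X L : Plane →L[ℝ] ℝ} {w p : Plane} (h : X p < X w) : wedge X L w p ≤ 0 := by
  rw [wedge, if_neg (not_le.2 h)]
  exact min_le_left _ _

theorem abs_wedge_le (X L : Plane →L[ℝ] ℝ) (w p : Plane) : |wedge X L w p| ≤ |L (p - w)| := by
  unfold wedge
  split_ifs
  · exact le_rfl
  · rcases le_total 0 (L (p - w)) with h | h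
    · rw [min_eq_left h]; simp
    · rw [min_eq_right h]

theorem integrable_wedge {α : Type*} [MeasurableSpace α] {μ : Measure α} [IsFiniteMeasure μ]
    (X L : Plane →L[ℝ] ℝ) (w : Plane) {φ : α → Plane} (hφ : Integrable φ μ) :
    Integrable (fun t => wedge X L w (φ t)) μ := by
  refine (L.integrable_comp (hφ.sub (integrable_const w))).mono
    ((measurable_wedge X L w).comp_aemeasurable hφ.aemeasurable).aestronglyMeasurable ?_
  exact Filter.Eventually.of_forall fun t => abs_wedge_le X L w (φ t)

/-- The functions `wedge` satisfy the Bellman inequality. -/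
theorem setAverage_wedge_le (X L : Plane →L[ℝ] ℝ) (w : Plane) {a b : ℝ} (hab : a < b)
    {φ : ℝ → Plane} (hφ : IntegrableOn φ (Ioo a b))
    {N : Set Plane}
    (hN : ∀ p ∈ N, X p = X w → L p ≤ L w) (hφN : ∀ t ∈ Ioo a b, φ t ∈ N)
    (h : ∀ p q, a ≤ p → p < q → q ≤ b → ⨍ t in Ioo p q, φ t ∈ N) :
    ⨍ t in Ioo a b, wedge X L w (φ t) ≤ wedge X L w (⨍ t in Ioo a b, φ t) := by
  have hba : 0 < b - a := sub_pos.2 hab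
  have hc : ∀ p q : ℝ, IntegrableOn (fun _ : ℝ => w) (Ioo p q) := fun p q =>
    integrableOn_const (by rw [Real.volume_Ioo]; exact ENNReal.ofReal_ne_top)
  have hw : IntegrableOn (fun t => wedge X L w (φ t)) (Ioo a b) := integrable_wedge X L w hφ
  have hL : IntegrableOn (fun t => L (φ t - w)) (Ioo a b) := L.integrable_comp (hφ.sub (hc a b))
  have hX : IntegrableOn (fun t => X (φ t - w)) (Ioo a b) := X.integrable_comp (hφ.sub (hc a b))
  have h1 : ∀ p q, a ≤ p → p < q → q ≤ b →
      ∫ t in Ioo p q, wedge X L w (φ t) ≤ (q - p) * L ((⨍ t in Ioo p q, φ t) - w) := by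
    intro p q hp hpq hq
    have hs := Ioo_subset_Ioo hp hq
    rw [← setIntegral_Ioo_clm L w hpq (hφ.mono_set hs)]
    exact setIntegral_mono (hw.mono_set hs) (hL.mono_set hs) fun t => wedge_le X L w (φ t)
  have h2 : ⨍ t in Ioo a b, wedge X L w (φ t) ≤ L ((⨍ t in Ioo a b, φ t) - w) := by
    rw [setAverage_Ioo hab, smul_eq_mul, inv_mul_le_iff₀ hba]
    exact h1 a b le_rfl hab le_rfl
  rw [wedge]
  split_ifs with hm
  · exact h2
  · refine le_min ?_ h2
    rw [setAverage_Ioo hab, smul_eq_mul]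
    -- Rising sun with `f = X (φ - w)`. When the integral of `f` over an interval vanishes, the
    -- average of `φ` there lies in `N` on the vertical line through `w`, so `hN` bounds `L` at it.
    refine mul_nonpos_of_nonneg_of_nonpos (inv_nonneg.2 hba.le) (rising_sun hab hX hw ?_ ?_ ?_)
    · rw [setIntegral_Ioo_clm X w hab hφ, map_sub]
      exact mul_nonpos_of_nonneg_of_nonpos hba.le (by linarith)
    · intro t htI ht
      rw [map_sub, sub_nonpos] at ht
      rcases ht.eq_or_lt with h3 | h3
      · refine (wedge_le X L w (φ t)).trans ?_
        rw [map_sub, sub_nonpos]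
        exact hN _ (hφN t htI) h3
      · exact wedge_nonpos h3
    · intro p q hp hpq hq h0
      rw [setIntegral_Ioo_clm X w hpq (hφ.mono_set (Ioo_subset_Ioo hp hq)), mul_eq_zero,
        map_sub] at h0
      have h3 := hN _ (h p q hp hpq hq) (by
        rcases h0 with h0 | h0
        · exact absurd h0 (sub_pos.2 hpq).ne'
        · linarith)
      refine (h1 p q hp hpq hq).trans (mul_nonpos_of_nonneg_of_nonpos (sub_pos.2 hpq).le ?_)
      rw [map_sub]
      linarith

/-! ### Recession directions of open convex sets -/

theorem mem_frontier_of_isOpen {K : Set Plane} (ho : IsOpen K) {p : Plane} :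
    p ∈ frontier K ↔ p ∈ closure K ∧ p ∉ K := by
  rw [ho.frontier_eq]; rfl

theorem combo_mem_of_closure {K : Set Plane} (ho : IsOpen K) (hK : Convex ℝ K) {p q : Plane}
    (hp : p ∈ closure K) (hq : q ∈ K) {s : ℝ} (h0 : 0 ≤ s) (h1 : s < 1) :
    s • p + (1 - s) • q ∈ K := by
  have := hK.combo_closure_interior_mem_interior hp (by rwa [ho.interior_eq]) h0 (sub_pos.2 h1)
    (by ring)
  rwa [ho.interior_eq] at this

/-- A ray from one point of the closure gives a parallel ray from every point `p` of `K`: segments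
from `p` to ever farther points of the given ray converge to it. This reaches only the closure; the
midpoint of `p` and `p + 2te` is then back in `K`. -/
theorem add_smul_mem_of_ray {K : Set Plane} (ho : IsOpen K) (hK : Convex ℝ K) {q e : Plane}
    (hq : ∀ t : ℝ, 0 ≤ t → q + t • e ∈ closure K) {p : Plane} (hp : p ∈ K) {t : ℝ} (ht : 0 ≤ t) :
    p + t • e ∈ K := by
  have hcl : ∀ t : ℝ, 0 ≤ t → p + t • e ∈ closure K := by
    intro t ht
    have hlim : Filter.Tendsto (fun n : ℕ => p + t • e + ((n : ℝ) + 1)⁻¹ • (q - p)) Filter.atTop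
        (𝓝 (p + t • e + (0 : ℝ) • (q - p))) := by
      have : Filter.Tendsto (fun n : ℕ => ((n : ℝ) + 1)⁻¹) Filter.atTop (𝓝 0) := by
        simpa [one_div] using tendsto_one_div_add_atTop_nhds_zero_nat (𝕜 := ℝ)
      exact tendsto_const_nhds.add (this.smul_const _)
    rw [zero_smul, add_zero] at hlim
    refine isClosed_closure.mem_of_tendsto hlim (Filter.Eventually.of_forall fun n => ?_)
    have hn : (0 : ℝ) < (n : ℝ) + 1 := by positivity
    have hn1 : ((n : ℝ) + 1)⁻¹ ≤ 1 := inv_le_one_of_one_le₀ (by linarith [n.cast_nonneg (α := ℝ)])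
    have := hK.closure (subset_closure hp) (hq (((n : ℝ) + 1) * t) (by positivity))
      (sub_nonneg.2 hn1) (inv_pos.2 hn).le (by ring)
    convert this using 1
    rw [smul_add, smul_smul, ← mul_assoc, inv_mul_cancel₀ hn.ne', one_mul]
    module
  have := combo_mem_of_closure ho hK (hcl (2 * t) (by positivity)) hp (s := 1 / 2)
    (by norm_num) (by norm_num)
  convert this using 1
  module

theorem exists_add_smul_mem_frontier {K : Set Plane} (ho : IsOpen K) {p d : Plane} (hp : p ∈ K)
    (h : ∃ t : ℝ, 0 ≤ t ∧ p + t • d ∉ K) : ∃ t : ℝ, 0 < t ∧ p + t • d ∈ frontier K := by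
  have hc : Continuous fun t : ℝ => p + t • d := by fun_prop
  set A : Set ℝ := Ici 0 ∩ (fun t : ℝ => p + t • d) ⁻¹' Kᶜ
  have hA : IsClosed A := isClosed_Ici.inter (ho.isClosed_compl.preimage hc)
  have hb : BddBelow A := ⟨0, fun t ht => ht.1⟩
  have hm : sInf A ∈ A := hA.csInf_mem (by obtain ⟨t, h1, h2⟩ := h; exact ⟨t, h1, h2⟩) hb
  have hpos : 0 < sInf A := by
    refine lt_of_le_of_ne hm.1 fun h0 => hm.2 ?_
    simpa [← h0] using hp
  refine ⟨sInf A, hpos, (mem_frontier_of_isOpen ho).2 ⟨?_, hm.2⟩⟩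
  have h1 : ∀ t ∈ Ioo 0 (sInf A), p + t • d ∈ K := fun t ht => by
    by_contra hn
    exact absurd (csInf_le hb ⟨ht.1.le, hn⟩) (not_le.2 ht.2)
  have h2 : sInf A ∈ closure (Ioo 0 (sInf A)) := by
    rw [closure_Ioo hpos.ne]; exact right_mem_Icc.2 hpos.le
  exact (hc.continuousAt.continuousWithinAt).mem_closure h2 h1

/-- The direction is a limit of unit vectors pointing to points of `K` that escape to infinity. -/
theorem exists_ray_of_not_isBounded {K : Set Plane} (ho : IsOpen K) (hK : Convex ℝ K)
    (hb : ¬ Bornology.IsBounded K) :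
    ∃ e : Plane, e ≠ 0 ∧ ∀ p ∈ K, ∀ t : ℝ, 0 ≤ t → p + t • e ∈ K := by
  obtain ⟨q, hq⟩ : K.Nonempty := by
    rw [nonempty_iff_ne_empty]; rintro rfl; exact hb Bornology.isBounded_empty
  have hfar : ∀ n : ℕ, ∃ p ∈ K, (n : ℝ) + 1 < ‖p - q‖ := by
    intro n
    by_contra! hc
    exact hb ((Metric.isBounded_closedBall (x := q) (r := (n : ℝ) + 1)).subset fun p hp => by
      rw [Metric.mem_closedBall, dist_eq_norm]; exact hc p hp)
  choose u hu hun using hfar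
  have hpos : ∀ n, 0 < ‖u n - q‖ := fun n =>
    lt_trans (by positivity : (0 : ℝ) < (n : ℝ) + 1) (hun n)
  set d : ℕ → Plane := fun n => ‖u n - q‖⁻¹ • (u n - q)
  have hd : ∀ n, d n ∈ Metric.sphere (0 : Plane) 1 := fun n => by
    rw [mem_sphere_zero_iff_norm, norm_smul, norm_inv, norm_norm, inv_mul_cancel₀ (hpos n).ne']
  obtain ⟨e, he, k, hk, hlim⟩ := (isCompact_sphere (0 : Plane) 1).tendsto_subseq hd
  refine ⟨e, ?_, fun p hp t ht => add_smul_mem_of_ray ho hK (q := q) (fun t ht => ?_) hp ht⟩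
  · rintro rfl
    simp at he
  · have hlim2 : Filter.Tendsto (fun n => q + t • d (k n)) Filter.atTop (𝓝 (q + t • e)) :=
      tendsto_const_nhds.add (hlim.const_smul t)
    refine isClosed_closure.mem_of_tendsto hlim2 ?_
    obtain ⟨N, hN⟩ := exists_nat_ge t
    filter_upwards [Filter.eventually_ge_atTop N] with n hn
    refine subset_closure ?_
    have h1 : t ≤ ‖u (k n) - q‖ := by
      have h2 : (N : ℝ) ≤ (k n : ℝ) := by exact_mod_cast hn.trans (hk.id_le n)
      linarith [hun (k n)]
    have h3 : t * ‖u (k n) - q‖⁻¹ ≤ 1 := by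
      rw [← div_eq_mul_inv]; exact (div_le_one (hpos _)).2 h1
    have := hK hq (hu (k n)) (sub_nonneg.2 h3) (mul_nonneg ht (inv_pos.2 (hpos (k n))).le)
      (by ring)
    convert this using 1
    simp only [d, smul_smul]
    module

/-! ### The vertical direction of the pair -/

/-- The linear functional `X` vanishes exactly on the multiples of `e`, and both sets of the pair
are invariant under translations by nonnegative multiples of `e`. -/
structure IsVertical (Ω₀ Ω₁ : Set Plane) (X : Plane →L[ℝ] ℝ) (e : Plane) : Prop where
  map_eq_zero : X e = 0
  exists_smul_eq : ∀ p, X p = 0 → ∃ t : ℝ, p = t • e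
  outer_mem : ∀ p ∈ Ω₀, ∀ t : ℝ, 0 ≤ t → p + t • e ∈ Ω₀
  inner_mem : ∀ p ∈ Ω₁, ∀ t : ℝ, 0 ≤ t → p + t • e ∈ Ω₁

theorem exists_coordinates {e : Plane} (he : e ≠ 0) : ∃ X Y : Plane →L[ℝ] ℝ,
    X e = 0 ∧ Y e = 1 ∧ ∀ p, X p = 0 → p = Y p • e := by
  have hpos : 0 < e 0 ^ 2 + e 1 ^ 2 := by
    rcases eq_or_ne (e 0) 0 with h0 | h0
    · rcases eq_or_ne (e 1) 0 with h1 | h1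
      · exact absurd (by ext i; fin_cases i <;> simpa) he
      · positivity
    · positivity
  set P0 : Plane →L[ℝ] ℝ := EuclideanSpace.proj (0 : Fin 2)
  set P1 : Plane →L[ℝ] ℝ := EuclideanSpace.proj (1 : Fin 2)
  refine ⟨e 0 • P1 - e 1 • P0, (e 0 ^ 2 + e 1 ^ 2)⁻¹ • (e 0 • P0 + e 1 • P1), ?_, ?_, fun p hp => ?_⟩
  · simp [P0, P1]; ring
  · simp [P0, P1]; field_simp
  · simp [P0, P1] at hp
    ext i
    fin_cases i
    · simp [P0, P1]; field_simp; linear_combination (-e 1) * hp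
    · simp [P0, P1]; field_simp; linear_combination (e 0) * hp

/-- The form in which the ray condition is used: recession directions of `Ω₀` are recession
directions of `Ω₁`, since one ray inside `Ω₁` suffices. -/
theorem inner_add_smul_mem {Ω₀ Ω₁ : Set Plane} (hΩ : IsPair Ω₀ Ω₁) (hray : RayCondition Ω₀ Ω₁)
    {e : Plane} (he : e ≠ 0) {q : Plane} (hq : ∀ t : ℝ, 0 ≤ t → q + t • e ∈ Ω₀) :
    Ω₁.Nonempty ∧ ∀ p ∈ Ω₁, ∀ t : ℝ, 0 ≤ t → p + t • e ∈ Ω₁ := by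
  obtain ⟨w, hw⟩ := hray.2 q e he hq
  refine ⟨⟨_, hw 0 le_rfl⟩, fun p hp t ht => add_smul_mem_of_ray hΩ.isOpen_inner hΩ.convex_inner
    (q := w + q) (fun t ht => subset_closure ?_) hp ht⟩
  rw [add_assoc]
  exact hw t ht

theorem exists_isVertical {Ω₀ Ω₁ : Set Plane} (hΩ : IsPair Ω₀ Ω₁) (hray : RayCondition Ω₀ Ω₁) :
    ∃ (X Y : Plane →L[ℝ] ℝ) (e : Plane), IsVertical Ω₀ Ω₁ X e ∧ Y e = 1 := by
  obtain ⟨e, he, hout⟩ := exists_ray_of_not_isBounded hΩ.isOpen_outer hΩ.convex_outer hray.1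
  obtain ⟨X, Y, hX, hY, hXY⟩ := exists_coordinates he
  obtain ⟨q, hq⟩ := hΩ.nonempty
  exact ⟨X, Y, e, ⟨hX, fun p hp => ⟨_, hXY p hp⟩, hout,
    (inner_add_smul_mem hΩ hray he (hout q hq)).2⟩, hY⟩

theorem IsVertical.neg {Ω₀ Ω₁ : Set Plane} {X : Plane →L[ℝ] ℝ} {e : Plane}
    (h : IsVertical Ω₀ Ω₁ X e) : IsVertical Ω₀ Ω₁ (-X) e :=
  ⟨by simp [h.map_eq_zero], fun p hp => h.exists_smul_eq p (by simpa using hp), h.outer_mem,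
    h.inner_mem⟩

theorem IsVertical.exists_ne_zero {Ω₀ Ω₁ : Set Plane} {X : Plane →L[ℝ] ℝ} {e : Plane}
    (h : IsVertical Ω₀ Ω₁ X e) : ∃ u, X u ≠ 0 := by
  by_contra! hc
  have hsurj : Function.Surjective (LinearMap.toSpanSingleton ℝ Plane e) := fun p => by
    obtain ⟨t, ht⟩ := h.exists_smul_eq p (hc p)
    exact ⟨t, ht.symm⟩
  have := LinearMap.finrank_le_finrank_of_surjective hsurj
  simp at this

/-- On a vertical line `K` is closed upwards, so a point outside `K` lies below any point of `K`.
For `K = Ω₁` this is the hypothesis needed by `wedge`; for `K = Ω₀` it locates `∂Ω₀` relative to a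
line. -/
theorem le_of_eq_of_notMem {K : Set Plane} {X L : Plane →L[ℝ] ℝ} {e : Plane}
    (hX : ∀ p, X p = 0 → ∃ t : ℝ, p = t • e) (hK : ∀ p ∈ K, ∀ t : ℝ, 0 ≤ t → p + t • e ∈ K)
    (hL : 0 < L e) {z p : Plane} (hz : z ∈ K) (hp : p ∉ K) (hpz : X p = X z) : L p ≤ L z := by
  obtain ⟨t, ht⟩ := hX (p - z) (by rw [map_sub, hpz, sub_self])
  have h1 : t < 0 := by
    by_contra! hc
    exact hp (by simpa [← ht] using hK z hz t hc)
  have h2 : L p - L z = t * L e := by rw [← map_sub, ht, map_smul, smul_eq_mul]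
  nlinarith

theorem segment_subset_frontier {K : Set Plane} (ho : IsOpen K) (hK : Convex ℝ K)
    (L : Plane →L[ℝ] ℝ) {p q : Plane} (hp : p ∈ closure K) (hq : q ∈ closure K)
    (hL : ∀ a ∈ K, L p < L a) (hpq : L p = L q) : segment ℝ p q ⊆ frontier K := by
  rintro x ⟨a, b, ha, hb, hab, rfl⟩
  refine (mem_frontier_of_isOpen ho).2 ⟨hK.closure hp hq ha hb hab, fun hx => ?_⟩
  have := hL _ hx
  rw [map_add, map_smul, map_smul, ← hpq, ← add_smul, hab, one_smul] at this
  exact lt_irrefl _ this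

/-- If a point of the segment between two frontier points on one vertical were in `Ω₀`, moving up
would put the upper endpoint in `Ω₀`. So the segment would lie in the frontier, against
`NoSegments`. -/
theorem IsVertical.injOn {Ω₀ Ω₁ : Set Plane} (hΩ : IsPair Ω₀ Ω₁) (h₀ : NoSegments (frontier Ω₀))
    {X : Plane →L[ℝ] ℝ} {e : Plane} (hX : IsVertical Ω₀ Ω₁ X e) : InjOn X (frontier Ω₀) := by
  have main : ∀ p ∈ frontier Ω₀, ∀ t : ℝ, 0 ≤ t → p + t • e ∈ frontier Ω₀ → p = p + t • e := by
    intro p hp t ht hq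
    by_contra hne
    refine h₀ p (p + t • e) hne ?_
    rintro x ⟨a, b, ha, hb, hab, rfl⟩
    rw [mem_frontier_of_isOpen hΩ.isOpen_outer] at hp hq ⊢
    refine ⟨hΩ.convex_outer.closure hp.1 hq.1 ha hb hab, fun hx => hq.2 ?_⟩
    have := hX.outer_mem _ hx (a * t) (mul_nonneg ha ht)
    convert this using 1
    obtain rfl : a = 1 - b := by linarith
    module
  intro p hp q hq hpq
  obtain ⟨t, ht⟩ := hX.exists_smul_eq (q - p) (by rw [map_sub]; exact sub_eq_zero.2 hpq.symm)
  rw [sub_eq_iff_eq_add'] at ht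
  rcases le_total 0 t with h | h
  · rw [ht]
    exact main p hp t h (ht ▸ hq)
  · have hp' : p = q + (-t) • e := by rw [ht]; module
    rw [hp']
    exact (main q hq (-t) (neg_nonneg.2 h) (hp' ▸ hp)).symm

/-! ### Position of the frontier relative to a line -/

section Wedge

variable {Ω₀ Ω₁ : Set Plane} {X L : Plane →L[ℝ] ℝ} {e v w : Plane}

/-- With the next two lemmas: from left to right, `∂Ω₀` is above the line through `v` and `w` before
`v`, below it from `v` to `w`, and above it for good once it has crossed to the right of `w`. In
each case a failure places a point of `Ω₀` below or level with a frontier point on the same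
vertical, against `le_of_eq_of_notMem`. -/
theorem frontier_ge_of_lt (hΩ : IsPair Ω₀ Ω₁) (hX : IsVertical Ω₀ Ω₁ X e) (hL : 0 < L e)
    (hv : v ∈ frontier Ω₀) (hw : w ∈ Ω₀) (hvw : X v < X w) (hLvw : L v = L w)
    {p : Plane} (hp : p ∈ frontier Ω₀) (hpv : X p < X v) : L w ≤ L p := by
  rw [mem_frontier_of_isOpen hΩ.isOpen_outer] at hp hv
  by_contra! hlt
  have hd : 0 < X w - X p := by linarith
  set s := (X w - X v) / (X w - X p)
  have hs0 : 0 < s := div_pos (by linarith) hd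
  have hs1 : s < 1 := (div_lt_one hd).2 (by linarith)
  have hsd : s * (X w - X p) = X w - X v := div_mul_cancel₀ _ hd.ne'
  have hz := combo_mem_of_closure hΩ.isOpen_outer hΩ.convex_outer hp.1 hw hs0.le hs1
  have hle := le_of_eq_of_notMem hX.exists_smul_eq hX.outer_mem hL hz hv.2 (by
    simp only [map_add, map_smul, smul_eq_mul]; linarith)
  simp only [map_add, map_smul, smul_eq_mul] at hle
  nlinarith

theorem frontier_le_of_mem_Icc (hΩ : IsPair Ω₀ Ω₁) (h₀ : NoSegments (frontier Ω₀))
    (hX : IsVertical Ω₀ Ω₁ X e) (hL : 0 < L e)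
    (hv : v ∈ frontier Ω₀) (hw : w ∈ Ω₀) (hvw : X v < X w) (hLvw : L v = L w)
    {p : Plane} (hp : p ∈ frontier Ω₀) (hpv : X v ≤ X p) (hpw : X p ≤ X w) : L p ≤ L w := by
  rcases hpv.eq_or_lt with h | h
  · rw [hX.injOn hΩ h₀ hp hv h.symm, hLvw]
  rw [mem_frontier_of_isOpen hΩ.isOpen_outer] at hp hv
  have hd : 0 < X w - X v := by linarith
  set s := (X w - X p) / (X w - X v)
  have hs0 : 0 ≤ s := div_nonneg (by linarith) hd.le
  have hs1 : s < 1 := (div_lt_one hd).2 (by linarith)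
  have hsd : s * (X w - X v) = X w - X p := div_mul_cancel₀ _ hd.ne'
  have hz := combo_mem_of_closure hΩ.isOpen_outer hΩ.convex_outer hv.1 hw hs0 hs1
  have hle := le_of_eq_of_notMem hX.exists_smul_eq hX.outer_mem hL hz hp.2 (by
    simp only [map_add, map_smul, smul_eq_mul]; linarith)
  simp only [map_add, map_smul, smul_eq_mul] at hle
  nlinarith

theorem frontier_ge_of_ge (hΩ : IsPair Ω₀ Ω₁) (h₀ : NoSegments (frontier Ω₀))
    (hX : IsVertical Ω₀ Ω₁ X e) (hL : 0 < L e) (hw : w ∈ Ω₀)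
    {p₀ p : Plane} (hp₀ : p₀ ∈ frontier Ω₀) (hwp₀ : X w < X p₀) (hLp₀ : L w < L p₀)
    (hp : p ∈ frontier Ω₀) (hpp₀ : X p₀ ≤ X p) : L w ≤ L p := by
  rcases hpp₀.eq_or_lt with h | h
  · rw [hX.injOn hΩ h₀ hp hp₀ h.symm]
    exact hLp₀.le
  rw [mem_frontier_of_isOpen hΩ.isOpen_outer] at hp hp₀
  by_contra! hlt
  have hd : 0 < X p - X w := by linarith
  set s := (X p₀ - X w) / (X p - X w)
  have hs0 : 0 ≤ s := div_nonneg (by linarith) hd.le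
  have hs1 : s < 1 := (div_lt_one hd).2 (by linarith)
  have hsd : s * (X p - X w) = X p₀ - X w := div_mul_cancel₀ _ hd.ne'
  have hz := combo_mem_of_closure hΩ.isOpen_outer hΩ.convex_outer hp.1 hw hs0 hs1
  have hle := le_of_eq_of_notMem hX.exists_smul_eq hX.outer_mem hL hz hp₀.2 (by
    simp only [map_add, map_smul, smul_eq_mul]; linarith)
  simp only [map_add, map_smul, smul_eq_mul] at hle
  nlinarith

end Wedge

/-! ### Coercivity and chords -/

/-- A linear functional that controls the norm on `Ω₀`. -/
theorem exists_coercive {Ω₀ Ω₁ : Set Plane} (hΩ : IsPair Ω₀ Ω₁) (h₀ : NoSegments (frontier Ω₀))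
    {X : Plane →L[ℝ] ℝ} {e : Plane} (hX : IsVertical Ω₀ Ω₁ X e) (he : e ≠ 0) :
    ∃ (N : Plane →L[ℝ] ℝ) (C : ℝ), ∀ p ∈ closure Ω₀, ‖p‖ ≤ N p + C := by
  obtain ⟨u, hu⟩ := hX.exists_ne_zero
  have down : ∀ p ∈ Ω₀, ∃ v ∈ frontier Ω₀, X v = X p := by
    intro p hp
    have : ∃ t : ℝ, 0 ≤ t ∧ p + t • (-e) ∉ Ω₀ := by
      by_contra! hc
      refine hΩ.no_line ⟨p, e, he, fun t => ?_⟩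
      rcases le_total 0 t with h | h
      · exact hX.outer_mem p hp t h
      · simpa using hc (-t) (neg_nonneg.2 h)
    obtain ⟨t, -, ht⟩ := exists_add_smul_mem_frontier hΩ.isOpen_outer hp this
    exact ⟨_, ht, by simp [hX.map_eq_zero]⟩
  obtain ⟨p, hp⟩ := hΩ.nonempty
  obtain ⟨v₁, hv₁, hXv₁⟩ := down p hp
  obtain ⟨s, hs, hs0⟩ : ∃ s : ℝ, p + s • u ∈ Ω₀ ∧ s ≠ 0 := by
    have hc : Continuous fun s : ℝ => p + s • u := by fun_prop
    have h1 : ∀ᶠ s : ℝ in 𝓝 0, p + s • u ∈ Ω₀ :=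
      hc.continuousAt.eventually_mem (by simpa using hΩ.isOpen_outer.mem_nhds hp)
    have h2 : ∀ᶠ s : ℝ in 𝓝[≠] 0, s ≠ 0 := self_mem_nhdsWithin
    exact ((h1.filter_mono nhdsWithin_le_nhds).and h2).exists
  obtain ⟨v₂, hv₂, hXv₂⟩ := down _ hs
  have hXne : X v₁ ≠ X v₂ := by
    rw [hXv₁, hXv₂, map_add, map_smul]
    simp [hs0, hu]
  have supp : ∀ v ∈ frontier Ω₀, ∃ L : Plane →L[ℝ] ℝ, (∀ a ∈ Ω₀, L v < L a) ∧
      (∀ a ∈ closure Ω₀, L v ≤ L a) ∧ 0 < L e := by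
    intro v hv
    obtain ⟨L, hL⟩ := geometric_hahn_banach_point_open hΩ.convex_outer hΩ.isOpen_outer
      ((mem_frontier_of_isOpen hΩ.isOpen_outer).1 hv).2
    have hLc : ∀ a ∈ closure Ω₀, L v ≤ L a := fun a ha =>
      closure_minimal (fun a ha => (hL a ha).le : Ω₀ ⊆ {a | L v ≤ L a})
        (isClosed_le continuous_const L.continuous) ha
    have hvc := ((mem_frontier_of_isOpen hΩ.isOpen_outer).1 hv).1
    have hve : v + e ∈ closure Ω₀ := by
      have hc : Continuous fun a : Plane => a + e := by fun_prop
      refine (hc.continuousAt.continuousWithinAt).mem_closure hvc fun a ha => ?_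
      simpa using hX.outer_mem a ha 1 zero_le_one
    refine ⟨L, hL, hLc, lt_of_le_of_ne ?_ fun h => ?_⟩
    · simpa using hLc _ hve
    · exact h₀ v (v + e) (by simpa using he) (segment_subset_frontier hΩ.isOpen_outer
        hΩ.convex_outer L hvc hve hL (by simp [← h]))
  obtain ⟨L₁, h1, h1c, h1e⟩ := supp v₁ hv₁
  obtain ⟨L₂, h2, h2c, h2e⟩ := supp v₂ hv₂
  have hc1 := ((mem_frontier_of_isOpen hΩ.isOpen_outer).1 hv₁).1
  have hc2 := ((mem_frontier_of_isOpen hΩ.isOpen_outer).1 hv₂).1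
  -- The supporting functionals at `v₁` and `v₂` are independent. Given a common kernel vector `d`,
  -- write `v₂ - v₁` as a multiple of `d` plus `r • e`; the two support inequalities force `r = 0`,
  -- so the segment from `v₁` to `v₂` would lie in `∂Ω₀`.
  have hker : ((L₁.prod L₂ : Plane →L[ℝ] ℝ × ℝ) : Plane →ₗ[ℝ] ℝ × ℝ).ker = ⊥ := by
    rw [LinearMap.ker_eq_bot']
    intro d hd
    obtain ⟨hd1, hd2⟩ : L₁ d = 0 ∧ L₂ d = 0 := by simpa using hd
    by_contra hne
    have hXd : X d ≠ 0 := fun h0 => by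
      obtain ⟨t, rfl⟩ := hX.exists_smul_eq d h0
      rw [map_smul, smul_eq_mul, mul_eq_zero] at hd1
      rcases hd1 with h | h
      · exact hne (by simp [h])
      · exact h1e.ne' h
    obtain ⟨r, hr⟩ := hX.exists_smul_eq (v₂ - v₁ - (X (v₂ - v₁) / X d) • d) (by
      rw [map_sub, map_smul, smul_eq_mul, div_mul_cancel₀ _ hXd, sub_self])
    have e1 : L₁ v₂ - L₁ v₁ = r * L₁ e := by
      have := congrArg L₁ hr
      simpa [hd1] using this
    have e2 : L₂ v₂ - L₂ v₁ = r * L₂ e := by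
      have := congrArg L₂ hr
      simpa [hd2] using this
    have i1 := h1c _ hc2
    have i2 := h2c _ hc1
    have hr0 : r = 0 := by
      refine le_antisymm ?_ ?_
      · by_contra! hc; nlinarith
      · by_contra! hc; nlinarith
    refine h₀ v₁ v₂ (fun h => hXne (by rw [h])) (segment_subset_frontier hΩ.isOpen_outer
      hΩ.convex_outer L₁ hc1 hc2 h1 ?_)
    rw [hr0, zero_mul] at e1
    linarith
  obtain ⟨K, -, hK⟩ := LinearMap.exists_antilipschitzWith _ hker
  refine ⟨(K : ℝ) • (L₁ + L₂), (K : ℝ) * (2 * |L₁ v₁| + 2 * |L₂ v₂|), fun p hp => ?_⟩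
  have hb := hK.le_mul_dist p 0
  rw [dist_zero_right, map_zero, dist_zero_right] at hb
  have hn : ‖((L₁.prod L₂ : Plane →L[ℝ] ℝ × ℝ) : Plane →ₗ[ℝ] ℝ × ℝ) p‖ ≤ |L₁ p| + |L₂ p| := by
    refine max_le ?_ ?_
    · exact le_add_of_nonneg_right (abs_nonneg (L₂ p))
    · exact le_add_of_nonneg_left (abs_nonneg (L₁ p))
  have a1 : |L₁ p| ≤ L₁ p + 2 * |L₁ v₁| := by
    have := h1c p hp
    rw [abs_le]
    constructor <;> linarith [neg_abs_le (L₁ v₁), abs_nonneg (L₁ v₁)]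
  have a2 : |L₂ p| ≤ L₂ p + 2 * |L₂ v₂| := by
    have := h2c p hp
    rw [abs_le]
    constructor <;> linarith [neg_abs_le (L₂ v₂), abs_nonneg (L₂ v₂)]
  calc ‖p‖ ≤ K * (|L₁ p| + |L₂ p|) := hb.trans (by gcongr)
    _ ≤ K * ((L₁ p + 2 * |L₁ v₁|) + (L₂ p + 2 * |L₂ v₂|)) := by gcongr
    _ = _ := by simp; ring

/-- Every point of `Ω₀` outside of `Ω₁` lies on a chord of `Ω₀` that does not meet `Ω₁`. -/
theorem exists_chord {Ω₀ Ω₁ : Set Plane} (hΩ : IsPair Ω₀ Ω₁)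
    (h₁ : NoSegments (frontier Ω₁)) (hray : RayCondition Ω₀ Ω₁) {N : Plane →L[ℝ] ℝ} {C : ℝ}
    (hN : ∀ p ∈ closure Ω₀, ‖p‖ ≤ N p + C) {x : Plane} (hx : x ∈ Ω₀) (hx₁ : x ∉ Ω₁) :
    ∃ A ∈ frontier Ω₀, ∃ B ∈ frontier Ω₀, ∃ θ : ℝ, 0 < θ ∧ θ < 1 ∧
      θ • A + (1 - θ) • B = x ∧ Disjoint (segment ℝ A B) Ω₁ := by
  have hNe : ∀ e : Plane, e ≠ 0 → (∀ t : ℝ, 0 ≤ t → x + t • e ∈ Ω₀) → 0 < N e := by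
    intro e he h
    by_contra! hc
    have hpos : 0 < ‖e‖ := norm_pos_iff.2 he
    set t := (‖x‖ + |N x| + |C| + 1) / ‖e‖
    have ht : t * ‖e‖ = ‖x‖ + |N x| + |C| + 1 := div_mul_cancel₀ _ hpos.ne'
    have ht0 : 0 ≤ t := by positivity
    have h1 := hN _ (subset_closure (h t ht0))
    have h2 : t * ‖e‖ ≤ ‖x + t • e‖ + ‖x‖ := by
      have := norm_sub_le (x + t • e) x
      rwa [add_sub_cancel_left, norm_smul, Real.norm_of_nonneg ht0] at this
    rw [map_add, map_smul, smul_eq_mul] at h1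
    nlinarith [le_abs_self (N x), le_abs_self C]
  obtain ⟨n, hn, hne⟩ : ∃ n : Plane →L[ℝ] ℝ, (∀ a ∈ Ω₁, n x < n a) ∧
      ∀ e : Plane, e ≠ 0 → (∀ t : ℝ, 0 ≤ t → x + t • e ∈ Ω₀) → 0 < n e := by
    have hnonneg : ∀ n : Plane →L[ℝ] ℝ, (∀ a ∈ Ω₁, n x < n a) → ∀ e : Plane, e ≠ 0 →
        (∀ t : ℝ, 0 ≤ t → x + t • e ∈ Ω₀) → 0 ≤ n e := by
      intro n hn e he h
      obtain ⟨⟨a, ha⟩, hin⟩ := inner_add_smul_mem hΩ hray he h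
      by_contra! hc
      have hxa := hn a ha
      set t := (n a - n x) / (-n e)
      have ht : t * (-n e) = n a - n x := div_mul_cancel₀ _ (by linarith)
      have := hn _ (hin a ha t (div_nonneg (by linarith) (by linarith)))
      rw [map_add, map_smul, smul_eq_mul] at this
      linarith
    -- Separation alone gives only `0 ≤ n e`. If `x ∈ closure Ω₁`, then `n e = 0` would create a
    -- segment in `∂Ω₁`; otherwise separation with a gap leaves room to add a multiple of `N`, which
    -- is positive on recession directions.
    by_cases hxc : x ∈ closure Ω₁
    · obtain ⟨n, hn⟩ := geometric_hahn_banach_point_open hΩ.convex_inner hΩ.isOpen_inner hx₁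
      refine ⟨n, hn, fun e he h => lt_of_le_of_ne (hnonneg n hn e he h) fun h0 => ?_⟩
      refine h₁ x (x + e) (by simpa using he) (segment_subset_frontier hΩ.isOpen_inner
        hΩ.convex_inner n hxc ?_ hn (by simp [← h0]))
      have hc : Continuous fun a : Plane => a + e := by fun_prop
      refine (hc.continuousAt.continuousWithinAt).mem_closure hxc fun a ha => ?_
      simpa using (inner_add_smul_mem hΩ hray he h).2 a ha 1 zero_le_one
    · obtain ⟨n, u, hxu, hu⟩ := geometric_hahn_banach_point_closed hΩ.convex_inner.closure
        isClosed_closure hxc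
      have hn : ∀ a ∈ Ω₁, n x < n a := fun a ha => hxu.trans (hu a (subset_closure ha))
      have hNx : 0 ≤ N x + C := (norm_nonneg x).trans (hN x (subset_closure hx))
      -- Chosen so that `(n + ε N) x = u - ε (C + 1)`, while `N ≥ -C` on `Ω₁` keeps `n + ε N` above
      -- `u - ε C` there.
      set ε := (u - n x) / (N x + C + 1)
      have hε : ε * (N x + C + 1) = u - n x := div_mul_cancel₀ _ (by linarith)
      have hε0 : 0 < ε := div_pos (by linarith) (by linarith)
      refine ⟨n + ε • N, fun a ha => ?_, fun e he h => ?_⟩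
      · have h1 := hu a (subset_closure ha)
        have h2 : 0 ≤ N a + C := (norm_nonneg a).trans
          (hN a (subset_closure (hΩ.closure_subset (subset_closure ha))))
        simp only [add_apply, smul_apply, smul_eq_mul]
        nlinarith
      · have := hnonneg n hn e he h
        have := mul_pos hε0 (hNe e he h)
        simp only [add_apply, smul_apply, smul_eq_mul]
        linarith
  -- The chord lies on the level line of `n` through `x`. Positivity of `n` on recession directions
  -- makes this line leave `Ω₀` on both sides.
  obtain ⟨d, hd, hnd⟩ : ∃ d : Plane, d ≠ 0 ∧ n d = 0 := by
    by_contra! hc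
    have hinj : Function.Injective (n : Plane →ₗ[ℝ] ℝ) := by
      rw [← LinearMap.ker_eq_bot, LinearMap.ker_eq_bot']
      intro d hd
      by_contra h
      exact hc d h hd
    have := LinearMap.finrank_le_finrank_of_injective hinj
    simp at this
  have exit : ∀ d : Plane, d ≠ 0 → n d = 0 → ∃ t : ℝ, 0 < t ∧ x + t • d ∈ frontier Ω₀ := by
    intro d hd hnd
    refine exists_add_smul_mem_frontier hΩ.isOpen_outer hx ?_
    by_contra! hc
    exact (hne d hd hc).ne' hnd
  obtain ⟨s, hs, hA⟩ := exit d hd hnd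
  obtain ⟨t, ht, hB⟩ := exit (-d) (neg_ne_zero.2 hd) (by simp [hnd])
  have hst : 0 < s + t := add_pos hs ht
  refine ⟨_, hA, _, hB, t / (s + t), by positivity, (div_lt_one hst).2 (by linarith), ?_, ?_⟩
  · have h1 : t / (s + t) * s = (1 - t / (s + t)) * t := by field_simp; ring
    calc _ = x + (t / (s + t) * s - (1 - t / (s + t)) * t) • d := by module
      _ = x := by rw [h1, sub_self, zero_smul, add_zero]
  · refine Set.disjoint_left.2 ?_
    rintro y ⟨a, b, ha, hb, hab, rfl⟩ hy
    have := hn _ hy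
    simp only [map_add, map_smul, map_neg, hnd, smul_zero, neg_zero, add_zero, ← add_smul, hab,
      one_smul, lt_irrefl] at this

/-! ### Jensen's inequality for countable convex combinations -/

theorem Convex.hasSum_mem_closure {ι : Type*} {C : Set Plane} (hC : Convex ℝ C) {α : ι → ℝ}
    {x : ι → Plane} {m : Plane} (hα : ∀ k, 0 ≤ α k) (hα1 : HasSum α 1) (hx : ∀ k, x k ∈ C)
    (hm : HasSum (fun k => α k • x k) m) : m ∈ closure C := by
  have hlim : Filter.Tendsto (fun F : Finset ι => (∑ k ∈ F, α k)⁻¹ • ∑ k ∈ F, α k • x k)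
      Filter.atTop (𝓝 ((1 : ℝ)⁻¹ • m)) := (Filter.Tendsto.inv₀ hα1 one_ne_zero).smul hm
  rw [inv_one, one_smul] at hlim
  refine mem_closure_of_tendsto hlim ?_
  filter_upwards [Filter.Tendsto.eventually_const_lt one_pos hα1] with F hF
  exact hC.centerMass_mem (fun k _ => hα k) hF fun k _ => hx k

/-- Jensen's inequality for the functions `wedge` at a point where they are nonpositive. -/
theorem tsum_wedge_nonpos {ι : Type*} {C : Set Plane} (hC : Convex ℝ C) {X L : Plane →L[ℝ] ℝ}
    {w m : Plane} (hCw : ∀ p ∈ closure C, X p = X w → L p ≤ L w) {α : ι → ℝ} {x : ι → Plane}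
    (hα : ∀ k, 0 ≤ α k) (hα1 : HasSum α 1) (hx : ∀ k, x k ∈ C)
    (hm : HasSum (fun k => α k • x k) m) (hmw : X m ≤ X w) {s : ℝ}
    (hs : HasSum (fun k => α k * wedge X L w (x k)) s) : s ≤ 0 := by
  -- If `C` has a point to the left of `w` above the line, it has none above the line to the right:
  -- the connecting segment would pass above `w`. Then all values of `wedge` are nonpositive.
  -- Otherwise `L m ≤ L w`, and the affine majorant of `wedge` suffices.
  by_cases hcase : ∃ p ∈ C, X p < X w ∧ L w < L p
  · obtain ⟨p, hp, hpX, hpL⟩ := hcase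
    have hle : ∀ k, wedge X L w (x k) ≤ 0 := by
      intro k
      rcases lt_or_ge (X (x k)) (X w) with h | h
      · exact wedge_nonpos h
      refine (wedge_le X L w (x k)).trans ?_
      by_contra! hc
      rw [map_sub, sub_pos] at hc
      have hd : 0 < X (x k) - X p := by linarith
      set r := (X w - X p) / (X (x k) - X p)
      have hr0 : 0 ≤ r := div_nonneg (by linarith) hd.le
      have hr1 : 0 ≤ 1 - r := sub_nonneg.2 ((div_le_one hd).2 (by linarith))
      have hrd : r * (X (x k) - X p) = X w - X p := div_mul_cancel₀ _ hd.ne'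
      have hz := hCw _ (subset_closure (hC hp (hx k) hr1 hr0 (by ring)))
        (by simp only [map_add, map_smul, smul_eq_mul]; linarith)
      simp only [map_add, map_smul, smul_eq_mul] at hz
      rcases hr0.eq_or_lt with h0 | h0
      · rw [← h0] at hz; linarith
      · nlinarith
    exact hs.nonpos fun k => mul_nonpos_of_nonneg_of_nonpos (hα k) (hle k)
  · push Not at hcase
    have hmC := Convex.hasSum_mem_closure hC hα hα1 hx hm
    have hLm : L m ≤ L w := by
      rcases hmw.eq_or_lt with h | h
      · exact hCw m hmC h
      · have ho : IsOpen {p | X p < X w} := isOpen_lt X.continuous continuous_const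
        have := ho.inter_closure ⟨h, hmC⟩
        exact closure_minimal (fun p hp => hcase p hp.2 hp.1 :
          {p | X p < X w} ∩ C ⊆ {p | L p ≤ L w}) (isClosed_le L.continuous continuous_const) this
    have hs2 : HasSum (fun k => α k * L (x k - w)) (L m - L w) := by
      have h1 := (L.hasSum hm).sub (hα1.mul_right (L w))
      rw [one_mul] at h1
      refine h1.congr_fun fun k => ?_
      simp only [map_smul, map_sub, smul_eq_mul]
      ring
    have := hasSum_le (fun k => mul_le_mul_of_nonneg_left (wedge_le X L w (x k)) (hα k)) hs hs2
    linarith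

/-! ### A bad average of a monotone function -/

section Core

variable {Ω₀ Ω₁ : Set Plane}

theorem inner_subset_outer (hΩ : IsPair Ω₀ Ω₁) : Ω₁ ⊆ Ω₀ :=
  subset_closure.trans hΩ.closure_subset

theorem notMem_inner_of_mem_frontier (hΩ : IsPair Ω₀ Ω₁) {p : Plane} (hp : p ∈ frontier Ω₀) :
    p ∉ Ω₁ := fun h =>
  ((mem_frontier_of_isOpen hΩ.isOpen_outer).1 hp).2 (inner_subset_outer hΩ h)

/-- If a monotone function has an average in `Ω₁`, then one of the functions `wedge` has a
positive integral. -/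
theorem exists_integral_wedge_pos (hΩ : IsPair Ω₀ Ω₁) (h₀ : NoSegments (frontier Ω₀))
    {X Y : Plane →L[ℝ] ℝ} {e : Plane} (hX : IsVertical Ω₀ Ω₁ X e) (hY : Y e = 1) {a b p q : ℝ}
    (hap : a ≤ p) (hpq : p < q) (hqb : q ≤ b) {ψ : ℝ → Plane}
    (hψ : IntegrableOn ψ (Ioo a b)) (hS : ∀ t, ψ t ∈ frontier Ω₀) {v : Plane} {d : ℝ}
    (hv : v ∈ frontier Ω₀) (hJ : ∀ᵐ t : ℝ, t ∈ Ioo p q → X v ≤ X (ψ t) ∧ X (ψ t) ≤ d)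
    (hJc : ∀ᵐ t : ℝ, t ∈ Ioo a b → t ∉ Ioo p q → X (ψ t) ≤ X v ∨ d ≤ X (ψ t))
    (hA : ⨍ t in Ioo p q, ψ t ∈ Ω₁) :
    ∃ w ∈ Ω₁, ∃ L : Plane →L[ℝ] ℝ, 0 < L e ∧ X w = X (⨍ t in Ioo p q, ψ t) ∧
      0 < ∫ t in Ioo a b, wedge X L w (ψ t) := by
  set A := ⨍ t in Ioo p q, ψ t with hAdef
  have hsub : Ioo p q ⊆ Ioo a b := Ioo_subset_Ioo hap hqb
  have hψJ := hψ.mono_set hsub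
  have hqp : 0 < q - p := sub_pos.2 hpq
  have hc : ∀ (w : Plane) (p q : ℝ), IntegrableOn (fun _ : ℝ => w) (Ioo p q) := fun w p q =>
    integrableOn_const (by rw [Real.volume_Ioo]; exact ENNReal.ofReal_ne_top)
  obtain ⟨ε, hε, hw⟩ : ∃ ε : ℝ, 0 < ε ∧ A + ε • (-e) ∈ Ω₁ := by
    have hcont : Continuous fun s : ℝ => A + s • (-e) := by fun_prop
    have h1 : ∀ᶠ s : ℝ in 𝓝 0, A + s • (-e) ∈ Ω₁ :=
      hcont.continuousAt.eventually_mem (by simpa using hΩ.isOpen_inner.mem_nhds hA)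
    have h2 : ∀ᶠ s : ℝ in 𝓝[>] 0, 0 < s := self_mem_nhdsWithin
    exact (h2.and (h1.filter_mono nhdsWithin_le_nhds)).exists
  set w := A + ε • (-e) with hwdef
  have hXw : X w = X A := by simp [hwdef, hX.map_eq_zero]
  -- Equality would force `ψ = v` almost everywhere on the interval, so `A = v` would be a frontier
  -- point of `Ω₀` inside `Ω₁`.
  have hvw : X v < X w := by
    have hnn : 0 ≤ᵐ[volume.restrict (Ioo p q)] fun t => X (ψ t - v) := by
      rw [Filter.EventuallyLE, ae_restrict_iff' measurableSet_Ioo]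
      filter_upwards [hJ] with t ht htJ
      simpa using (ht htJ).1
    have hint := setIntegral_Ioo_clm X v hpq hψJ
    have h1 := integral_nonneg_of_ae hnn
    rw [hint, mul_nonneg_iff_of_pos_left hqp, map_sub, sub_nonneg] at h1
    rw [hXw]
    refine lt_of_le_of_ne h1 fun heq => notMem_inner_of_mem_frontier hΩ hv ?_
    rw [← hAdef, map_sub, heq, sub_self, mul_zero, integral_eq_zero_iff_of_nonneg_ae hnn
      (X.integrable_comp (hψJ.sub (hc v p q)))] at hint
    have hAv : A = v := by
      have h2 : ∫ t in Ioo p q, ψ t = ∫ _ in Ioo p q, v := by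
        refine integral_congr_ae ?_
        filter_upwards [hint] with t ht
        refine hX.injOn hΩ h₀ (hS t) hv ?_
        have : X (ψ t - v) = 0 := ht
        rwa [map_sub, sub_eq_zero] at this
      rw [hAdef, setAverage_Ioo hpq, h2, setIntegral_const, Measure.real, Real.volume_Ioo,
        ENNReal.toReal_ofReal hqp.le, smul_smul, inv_mul_cancel₀ hqp.ne', one_smul]
    exact hAv ▸ hA
  -- `L` is normalized by `L e = 1` and constant on the line through `v` and `w`; hence `L (A - w) =
  -- ε`.
  set L : Plane →L[ℝ] ℝ := Y - (Y (v - w) / X (v - w)) • X with hLdef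
  have hLe : L e = 1 := by simp [hLdef, hX.map_eq_zero, hY]
  have hLe0 : 0 < L e := hLe ▸ one_pos
  have hLvw : L v = L w := by
    have h1 : X (v - w) ≠ 0 := by rw [map_sub]; exact (sub_neg.2 hvw).ne
    rw [← sub_eq_zero, ← map_sub]
    simp only [hLdef, sub_apply, smul_apply, smul_eq_mul]
    rw [div_mul_cancel₀ _ h1, sub_self]
  have hw0 : w ∈ Ω₀ := inner_subset_outer hΩ hw
  refine ⟨w, hw, L, hLe0, hXw, ?_⟩
  have hLJ : 0 < ∫ t in Ioo p q, L (ψ t - w) := by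
    rw [setIntegral_Ioo_clm L w hpq hψJ, ← hAdef]
    refine mul_pos hqp ?_
    have : A - w = ε • e := by rw [hwdef]; module
    rw [this, map_smul, smul_eq_mul, hLe, mul_one]
    exact hε
  have hle : ∀ t, X v ≤ X (ψ t) → X (ψ t) ≤ X w → L (ψ t) ≤ L w := fun t h1 h2 =>
    frontier_le_of_mem_Icc hΩ h₀ hX hLe0 hv hw0 hvw hLvw (hS t) h1 h2
  -- Since `L (ψ - w)` has positive integral over the interval, some value of `ψ` with `X ≤ d` is
  -- above the line. It is to the right of `w`, so the frontier stays above the line beyond `d`.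
  obtain ⟨t₀, ht₀, hwt₀, ht₀d⟩ : ∃ t₀, L w < L (ψ t₀) ∧ X w < X (ψ t₀) ∧ X (ψ t₀) ≤ d := by
    by_contra! hno
    refine absurd hLJ (not_lt.2 (setIntegral_nonpos_ae measurableSet_Ioo ?_))
    filter_upwards [hJ] with t ht htJ
    rw [map_sub, sub_nonpos]
    by_contra! hlt
    have h1 : X w < X (ψ t) := by
      by_contra! h2
      exact absurd (hle t (ht htJ).1 h2) (not_le.2 hlt)
    exact absurd (ht htJ).2 (not_le.2 (hno t hlt h1))
  have hind : ∫ t in Ioo p q, L (ψ t - w) =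
      ∫ t in Ioo a b, (Ioo p q).indicator (fun t => L (ψ t - w)) t := by
    rw [setIntegral_indicator measurableSet_Ioo, inter_eq_self_of_subset_right hsub]
  rw [hind] at hLJ
  -- Pointwise `wedge ≥ 1_J L (ψ - w)`: the truncation is inactive on `J`, gives `0` to the left of
  -- `v`, and the affine part is nonnegative beyond `d`.
  refine hLJ.trans_le (integral_mono_ae ?_ (integrable_wedge X L w hψ) ?_)
  · exact (L.integrable_comp (hψ.sub (hc w a b))).indicator measurableSet_Ioo
  · rw [Filter.EventuallyLE, ae_restrict_iff' measurableSet_Ioo]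
    filter_upwards [hJ, hJc] with t h1 h2 htI
    by_cases htJ : t ∈ Ioo p q
    · rw [indicator_of_mem htJ, wedge]
      split_ifs with h3
      · exact le_rfl
      · refine le_min ?_ le_rfl
        rw [map_sub, sub_nonpos]
        exact hle t (h1 htJ).1 (not_le.1 h3).le
    · rw [indicator_of_notMem htJ]
      rcases h2 htI htJ with h3 | h3
      · rw [wedge, if_neg (not_le.2 (h3.trans_lt hvw))]
        refine le_min le_rfl ?_
        rw [map_sub, sub_nonneg]
        rcases h3.eq_or_lt with h4 | h4
        · rw [hX.injOn hΩ h₀ (hS t) hv h4, hLvw]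
        · exact frontier_ge_of_lt hΩ hX hLe0 hv hw0 hvw hLvw (hS t) h4
      · rw [wedge, if_pos (hwt₀.le.trans (ht₀d.trans h3)), map_sub, sub_nonneg]
        exact frontier_ge_of_ge hΩ h₀ hX hLe0 hw0 (hS t₀) hwt₀ ht₀ (hS t) (ht₀d.trans h3)

theorem tendsto_setAverage_left {E : Type*} [NormedAddCommGroup E] [NormedSpace ℝ E] {p q : ℝ}
    (hpq : p < q) {ψ : ℝ → E} (hψ : IntegrableOn ψ (Ioo p q)) :
    Filter.Tendsto (fun s => ⨍ t in Ioo s q, ψ t) (𝓝[>] p) (𝓝 (⨍ t in Ioo p q, ψ t)) := by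
  have hi : IntervalIntegrable ψ volume p q :=
    (intervalIntegrable_iff_integrableOn_Ioo_of_le hpq.le).2 hψ
  have hc := intervalIntegral.continuousOn_primitive_interval_left
    (by
      rw [uIcc_of_le hpq.le]
      exact (integrableOn_Icc_iff_integrableOn_Ioo (by simp) (by simp)).2 hψ :
      IntegrableOn ψ (uIcc p q) volume)
  have h1 := (hc p left_mem_uIcc).tendsto
  have h2 : Filter.Tendsto (fun s => ∫ t in s..q, ψ t) (𝓝[>] p) (𝓝 (∫ t in p..q, ψ t)) := by
    refine h1.mono_left (nhdsWithin_le_of_mem ?_)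
    filter_upwards [Ioo_mem_nhdsGT hpq] with s hs
    rw [uIcc_of_le hpq.le]
    exact Ioo_subset_Icc_self hs
  have h3 : Filter.Tendsto (fun s => (q - s)⁻¹) (𝓝[>] p) (𝓝 (q - p)⁻¹) :=
    ((tendsto_const_nhds.sub Filter.tendsto_id).mono_left nhdsWithin_le_nhds).inv₀
      (sub_pos.2 hpq).ne'
  have h4 := h3.smul h2
  rw [intervalIntegral.integral_of_le hpq.le, integral_Ioc_eq_integral_Ioo,
    ← setAverage_Ioo hpq] at h4
  refine h4.congr' ?_
  filter_upwards [Ioo_mem_nhdsGT hpq] with s hs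
  rw [intervalIntegral.integral_of_le hs.2.le, integral_Ioc_eq_integral_Ioo,
    ← setAverage_Ioo hs.2]

theorem tendsto_setAverage_right {E : Type*} [NormedAddCommGroup E] [NormedSpace ℝ E] {p q : ℝ}
    (hpq : p < q) {ψ : ℝ → E} (hψ : IntegrableOn ψ (Ioo p q)) :
    Filter.Tendsto (fun s => ⨍ t in Ioo p s, ψ t) (𝓝[<] q) (𝓝 (⨍ t in Ioo p q, ψ t)) := by
  have hc := intervalIntegral.continuousOn_primitive_interval
    (by
      rw [uIcc_of_le hpq.le]
      exact (integrableOn_Icc_iff_integrableOn_Ioo (by simp) (by simp)).2 hψ :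
      IntegrableOn ψ (uIcc p q) volume)
  have h1 := (hc q right_mem_uIcc).tendsto
  have h2 : Filter.Tendsto (fun s => ∫ t in p..s, ψ t) (𝓝[<] q) (𝓝 (∫ t in p..q, ψ t)) := by
    refine h1.mono_left (nhdsWithin_le_of_mem ?_)
    filter_upwards [Ioo_mem_nhdsLT hpq] with s hs
    rw [uIcc_of_le hpq.le]
    exact Ioo_subset_Icc_self hs
  have h3 : Filter.Tendsto (fun s => (s - p)⁻¹) (𝓝[<] q) (𝓝 (q - p)⁻¹) :=
    ((Filter.tendsto_id.sub tendsto_const_nhds).mono_left nhdsWithin_le_nhds).inv₀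
      (sub_pos.2 hpq).ne'
  have h4 := h3.smul h2
  rw [intervalIntegral.integral_of_le hpq.le, integral_Ioc_eq_integral_Ioo,
    ← setAverage_Ioo hpq] at h4
  refine h4.congr' ?_
  filter_upwards [Ioo_mem_nhdsLT hpq] with s hs
  rw [intervalIntegral.integral_of_le hs.1.le, integral_Ioc_eq_integral_Ioo,
    ← setAverage_Ioo hs.1]

/-- An average over an interval with an open property can be replaced by the average over a
smaller interval whose endpoints have a property that holds almost everywhere. -/
theorem exists_setAverage_mem {p q : ℝ} (hpq : p < q) {ψ : ℝ → Plane}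
    (hψ : IntegrableOn ψ (Ioo p q)) {K : Set Plane} (hK : IsOpen K)
    (h : ⨍ t in Ioo p q, ψ t ∈ K) {P : ℝ → Prop} (hP : ∀ᵐ t : ℝ, P t) :
    ∃ p' q' : ℝ, p < p' ∧ p' < q' ∧ q' < q ∧ P p' ∧ P q' ∧ ⨍ t in Ioo p' q', ψ t ∈ K := by
  have hd : Dense {t | P t} := Measure.dense_of_ae hP
  obtain ⟨u, hu, hsub⟩ := (mem_nhdsGT_iff_exists_Ioo_subset' hpq).1
    (((tendsto_setAverage_left hpq hψ).eventually_mem (hK.mem_nhds h)).and (Ioo_mem_nhdsGT hpq))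
  obtain ⟨p', hPp', hp', hp'u⟩ := hd.exists_between hu
  obtain ⟨hm, -, hp'q⟩ := hsub ⟨hp', hp'u⟩
  have hψ' := hψ.mono_set (Ioo_subset_Ioo_left hp'.le)
  obtain ⟨l, hl, hsub'⟩ := (mem_nhdsLT_iff_exists_Ioo_subset' hp'q).1
    (((tendsto_setAverage_right hp'q hψ').eventually_mem (hK.mem_nhds hm)).and
      (Ioo_mem_nhdsLT hp'q))
  obtain ⟨q', hPq', hlq', hq'⟩ := hd.exists_between hl
  obtain ⟨hm', hp'q', -⟩ := hsub' ⟨hlq', hq'⟩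
  exact ⟨p', q', hp', hp'q', hq', hPp', hPq', hm'⟩

end Core

/-! ### Distributions of functions of the class -/

section Class

variable {Ω₀ Ω₁ : Set Plane} {I : Set ℝ}

theorem MemA.integrable_cond (hI : IsInterval I) {φ : ℝ → Plane} (h : MemA Ω₀ Ω₁ I φ) :
    Integrable φ (ProbabilityTheory.cond volume I) := IntegrableOn.integrable_cond hI h.integrable

theorem integral_distribution {E : Type*} [NormedAddCommGroup E] [NormedSpace ℝ E]
    (hI : IsInterval I) {φ : ℝ → Plane} (h : IntegrableOn φ I) {g : Plane → E}
    (hg : StronglyMeasurable g) :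
    ∫ p, g p ∂(distribution I φ) = ⨍ t in I, g (φ t) := by
  rw [setAverage_eq_integral_cond]
  exact integral_map (IntegrableOn.integrable_cond hI h).aemeasurable hg.aestronglyMeasurable

theorem isProbabilityMeasure_distribution (hI : IsInterval I) {φ : ℝ → Plane}
    (h : IntegrableOn φ I) : IsProbabilityMeasure (distribution I φ) := by
  have := hI.isProbabilityMeasure_cond
  exact Measure.isProbabilityMeasure_map (IntegrableOn.integrable_cond hI h).aemeasurable

theorem ae_cond_of_forall_mem (hI : IsInterval I) {P : ℝ → Prop} (h : ∀ t ∈ I, P t) :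
    ∀ᵐ t ∂(ProbabilityTheory.cond volume I), P t := by
  have h1 : ∀ᵐ t ∂(volume.restrict I), P t :=
    (ae_restrict_iff'₀ (hI.ordConnected.measurableSet.nullMeasurableSet)).2
      (Filter.Eventually.of_forall h)
  exact (Measure.smul_absolutelyContinuous : _ ≪ volume.restrict I).ae_le h1

theorem distribution_apply_compl_eq_zero (hI : IsInterval I) {φ : ℝ → Plane}
    (h : IntegrableOn φ I) {S : Set Plane} (hS : MeasurableSet S) (hφ : ∀ t ∈ I, φ t ∈ S) :
    distribution I φ Sᶜ = 0 := by
  rw [distribution, Measure.map_apply_of_aemeasurable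
    (IntegrableOn.integrable_cond hI h).aemeasurable hS.compl]
  exact ae_cond_of_forall_mem hI hφ

theorem restrict_absolutelyContinuous_cond (hI : IsInterval I) :
    (volume.restrict I : Measure ℝ) ≪ ProbabilityTheory.cond volume I := by
  obtain ⟨a, b, hab, h1, h2⟩ := hI.exists_Ioo
  exact Measure.absolutelyContinuous_smul
    (ENNReal.inv_ne_zero.2 ((measure_mono h2).trans_lt measure_Icc_lt_top).ne)

/-- The class `A_Ω` only depends on the values almost everywhere. -/
theorem MemA.congr (hI : IsInterval I) {φ ψ : ℝ → Plane} (h : MemA Ω₀ Ω₁ I φ)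
    (hψ : ∀ t ∈ I, ψ t ∈ frontier Ω₀) (hae : φ =ᵐ[ProbabilityTheory.cond volume I] ψ) :
    MemA Ω₀ Ω₁ I ψ := by
  have hae' : φ =ᵐ[volume.restrict I] ψ := (restrict_absolutelyContinuous_cond hI).ae_le hae
  refine ⟨h.integrable.congr hae', hψ, fun J hJ hJI => ?_⟩
  have := h.average_notMem J hJ hJI
  have h2 : φ =ᵐ[volume.restrict J] ψ := ae_restrict_of_ae_restrict_of_subset hJI hae'
  rwa [average_congr h2] at this

/-- A probability measure on `∂Ω₀` that satisfies the Bellman inequalities for the functions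
`wedge` is the distribution of a function of class `A_Ω`. -/
theorem exists_memA_of_wedge (hΩ : IsPair Ω₀ Ω₁) (h₀ : NoSegments (frontier Ω₀))
    {X Y : Plane →L[ℝ] ℝ} {e : Plane} (hX : IsVertical Ω₀ Ω₁ X e) (hY : Y e = 1)
    (hI : IsInterval I) (μ : Measure Plane) [IsProbabilityMeasure μ]
    (hμS : μ (frontier Ω₀)ᶜ = 0) (hμ : Integrable (fun p => p) μ)
    (hμ1 : ∀ w ∈ Ω₁, ∀ L : Plane →L[ℝ] ℝ, 0 < L e → X (∫ p, p ∂μ) ≤ X w →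
      ∫ p, wedge X L w p ∂μ ≤ 0)
    (hμ2 : ∀ w ∈ Ω₁, ∀ L : Plane →L[ℝ] ℝ, 0 < L e → X w ≤ X (∫ p, p ∂μ) →
      ∫ p, wedge (-X) L w p ∂μ ≤ 0) :
    ∃ ψ : ℝ → Plane, MemA Ω₀ Ω₁ I ψ ∧ distribution I ψ = μ := by
  obtain ⟨a, b, hab, hI1, hI2⟩ := hI.exists_Ioo
  have hXm : Measurable X := X.continuous.measurable
  have hSc : IsClosed (frontier Ω₀) := isClosed_frontier
  have hprobX : IsProbabilityMeasure (μ.map X) := Measure.isProbabilityMeasure_map hXm.aemeasurable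
  obtain ⟨Q, hQmono, hQmeas, hQmap⟩ := exists_quantile (μ.map X) hab
  have hSne : (frontier Ω₀).Nonempty := by
    rw [nonempty_iff_ne_empty]
    intro h
    rw [h, compl_empty, measure_univ] at hμS
    exact one_ne_zero hμS
  have hSne' : Nonempty (frontier Ω₀) := hSne.to_subtype
  have : StandardBorelSpace (frontier Ω₀) := hSc.measurableSet.standardBorel
  have hemb : MeasurableEmbedding fun s : frontier Ω₀ => X s :=
    (hXm.comp measurable_subtype_coe).measurableEmbedding
      fun s t hst => Subtype.ext (hX.injOn hΩ h₀ s.2 t.2 hst)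
  obtain ⟨G, hGm, hG⟩ := hemb.exists_measurable_extend measurable_id fun _ => hSne'
  have hGX : ∀ p ∈ frontier Ω₀, (G (X p) : Plane) = p := fun p hp => by
    have := congrFun hG ⟨p, hp⟩
    exact congrArg Subtype.val this
  have hGm' : Measurable fun x => (G x : Plane) := measurable_subtype_coe.comp hGm
  set ψ : ℝ → Plane := fun t => G (Q t) with hψdef
  have hψS : ∀ t, ψ t ∈ frontier Ω₀ := fun t => (G (Q t)).2
  have hprob := isProbabilityMeasure_cond_Ioo hab
  have hcond := cond_eq_of_between hI1 hI2
  have hrestr := restrict_eq_of_between hI1 hI2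
  have hQm2 : AEMeasurable Q (ProbabilityTheory.cond volume (Ioo a b)) := hQmeas.smul_measure _
  have hμae : ∀ᵐ p ∂μ, p ∈ frontier Ω₀ := hμS
  have hψm : AEMeasurable ψ (ProbabilityTheory.cond volume (Ioo a b)) :=
    hGm'.comp_aemeasurable hQm2
  have hdist' : Measure.map ψ (ProbabilityTheory.cond volume (Ioo a b)) = μ := by
    have h1 : Measure.map ψ (ProbabilityTheory.cond volume (Ioo a b)) =
        Measure.map (fun x => (G x : Plane)) (μ.map X) := by
      rw [← hQmap, AEMeasurable.map_map_of_aemeasurable hGm'.aemeasurable hQm2]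
      rfl
    rw [h1, Measure.map_map hGm' hXm]
    conv_rhs => rw [← Measure.map_id (μ := μ)]
    refine Measure.map_congr ?_
    filter_upwards [hμae] with p hp
    exact hGX p hp
  have hdist : distribution I ψ = μ := by rw [distribution, hcond, hdist']
  have hψint : IntegrableOn ψ (Ioo a b) := by
    have h1 : Integrable ψ (ProbabilityTheory.cond volume (Ioo a b)) := by
      rw [← hdist'] at hμ
      exact hμ.comp_aemeasurable hψm
    rw [ProbabilityTheory.cond, integrable_smul_measure] at h1
    · exact h1
    · rw [Real.volume_Ioo]; exact ENNReal.inv_ne_zero.2 ENNReal.ofReal_ne_top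
    · rw [Real.volume_Ioo]; simpa using hab
  have hψI : IntegrableOn ψ I := by rwa [IntegrableOn, hrestr]
  have hwedge : ∀ (Z L : Plane →L[ℝ] ℝ) (w : Plane),
      ∫ p, wedge Z L w p ∂μ = (b - a)⁻¹ * ∫ t in Ioo a b, wedge Z L w (ψ t) := by
    intro Z L w
    rw [← hdist, integral_distribution hI hψI (measurable_wedge Z L w).stronglyMeasurable,
      setAverage_eq_of_between hI1 hI2, setAverage_Ioo hab, smul_eq_mul]
  have hQae : ∀ᵐ t : ℝ, t ∈ Ioo a b → X (ψ t) = Q t := by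
    have h1 : ∀ᵐ x ∂(μ.map X), X (G x) = x := by
      refine (ae_map_iff hXm.aemeasurable
        (measurableSet_eq_fun (hXm.comp hGm') measurable_id)).2 ?_
      filter_upwards [hμae] with p hp
      exact congrArg X (hGX p hp)
    rw [← hQmap] at h1
    have h2 := ae_of_ae_map hQm2 h1
    exact (ae_restrict_iff' measurableSet_Ioo).1
      ((restrict_absolutelyContinuous_cond (isInterval_Ioo hab)).ae_le h2)
  refine ⟨ψ, ⟨hψI, fun t _ => hψS t, fun J hJ hJI hA => ?_⟩, hdist⟩
  obtain ⟨p, q, hpq, hJ1, hJ2⟩ := hJ.exists_Ioo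
  rw [setAverage_eq_of_between hJ1 hJ2] at hA
  have hsub : Icc p q ⊆ Icc a b := by
    rw [← closure_Ioo hpq.ne]
    exact closure_minimal ((hJ1.trans hJI).trans hI2) isClosed_Icc
  have hap : a ≤ p := (hsub (left_mem_Icc.2 hpq.le)).1
  have hqb : q ≤ b := (hsub (right_mem_Icc.2 hpq.le)).2
  -- `X ∘ ψ = Q` holds only almost everywhere. Since `Ω₁` is open, the interval can be shrunk until
  -- both endpoints are good, and the frontier points there bound the arc.
  obtain ⟨p', q', hpp', hpq', hqq', hPp, hPq, hA'⟩ := exists_setAverage_mem hpq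
    (hψint.mono_set (Ioo_subset_Ioo hap hqb)) hΩ.isOpen_inner hA hQae
  have hp'I : p' ∈ Ioo a b := ⟨hap.trans_lt hpp', (hpq'.trans hqq').trans_le hqb⟩
  have hq'I : q' ∈ Ioo a b := ⟨hp'I.1.trans hpq', hqq'.trans_le hqb⟩
  have hin : ∀ᵐ t : ℝ, t ∈ Ioo p' q' → X (ψ p') ≤ X (ψ t) ∧ X (ψ t) ≤ X (ψ q') := by
    filter_upwards [hQae] with t ht htJ
    have htI : t ∈ Ioo a b := Ioo_subset_Ioo hp'I.1.le hq'I.2.le htJ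
    rw [ht htI, hPp hp'I, hPq hq'I]
    exact ⟨hQmono hp'I htI htJ.1.le, hQmono htI hq'I htJ.2.le⟩
  have hout : ∀ᵐ t : ℝ, t ∈ Ioo a b → t ∉ Ioo p' q' →
      X (ψ t) ≤ X (ψ p') ∨ X (ψ q') ≤ X (ψ t) := by
    filter_upwards [hQae] with t ht htI htJ
    rw [ht htI, hPp hp'I, hPq hq'I]
    rcases le_or_gt t p' with h | h
    · exact Or.inl (hQmono htI hp'I h)
    · exact Or.inr (hQmono hq'I htI (not_lt.1 fun h' => htJ ⟨h, h'⟩))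
  have hba : 0 < (b - a)⁻¹ := inv_pos.2 (sub_pos.2 hab)
  -- In the second case `-X` reverses the order, so the right endpoint plays the role of `v`.
  rcases le_total (X (∫ p, p ∂μ)) (X (⨍ t in Ioo p' q', ψ t)) with h | h
  · obtain ⟨w, hw, L, hL, hXw, hpos⟩ := exists_integral_wedge_pos hΩ h₀ hX hY hp'I.1.le hpq'
      hq'I.2.le hψint hψS (hψS p') hin hout hA'
    have := hμ1 w hw L hL (hXw ▸ h)
    rw [hwedge] at this
    exact absurd (mul_pos hba hpos) (not_lt.2 this)
  · obtain ⟨w, hw, L, hL, hXw, hpos⟩ := exists_integral_wedge_pos hΩ h₀ hX.neg hY hp'I.1.le hpq'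
      hq'I.2.le hψint hψS (v := ψ q') (d := (-X) (ψ p')) (hψS q') (by
        filter_upwards [hin] with t ht htJ
        simpa using (ht htJ).symm) (by
        filter_upwards [hout] with t ht htI htJ
        simpa using (ht htI htJ).symm) hA'
    simp only [neg_apply, neg_inj] at hXw
    have := hμ2 w hw L hL (hXw ▸ h)
    rw [hwedge] at this
    exact absurd (mul_pos hba hpos) (not_lt.2 this)

/-! ### Mixtures -/

/-- The mixture of the distributions of functions of class `A_Ω`. -/
noncomputable def mixture {ι : Type*} (I : Set ℝ) (α : ι → ℝ) (φ : ι → ℝ → Plane) :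
    Measure Plane :=
  Measure.sum fun k => ENNReal.ofReal (α k) • distribution I (φ k)

theorem hasSum_integral_mixture {ι : Type*} [Countable ι] (hI : IsInterval I) {α : ι → ℝ}
    (hα : ∀ k, 0 ≤ α k) {φ : ι → ℝ → Plane} (hφ : ∀ k, IntegrableOn (φ k) I)
    {E : Type*} [NormedAddCommGroup E] [NormedSpace ℝ E] {g : Plane → E}
    (hg : StronglyMeasurable g) (hgi : Integrable g (mixture I α φ)) :
    HasSum (fun k => α k • ⨍ t in I, g (φ k t)) (∫ p, g p ∂(mixture I α φ)) := by
  have h := hasSum_integral_measure hgi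
  refine h.congr_fun fun k => ?_
  rw [integral_smul_measure, integral_distribution hI (hφ k) hg, ENNReal.toReal_ofReal (hα k)]

theorem isProbabilityMeasure_mixture {ι : Type*} (hI : IsInterval I) {α : ι → ℝ}
    (hα : ∀ k, 0 ≤ α k) (hα1 : HasSum α 1) {φ : ι → ℝ → Plane} (hφ : ∀ k, IntegrableOn (φ k) I) :
    IsProbabilityMeasure (mixture I α φ) := by
  constructor
  rw [mixture, Measure.sum_apply _ MeasurableSet.univ]
  have : ∀ k, (ENNReal.ofReal (α k) • distribution I (φ k)) univ = ENNReal.ofReal (α k) := by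
    intro k
    have := isProbabilityMeasure_distribution hI (hφ k)
    simp
  simp_rw [this]
  rw [← ENNReal.ofReal_tsum_of_nonneg hα hα1.summable, hα1.tsum_eq, ENNReal.ofReal_one]

theorem mixture_apply_eq_zero {ι : Type*} {α : ι → ℝ} {φ : ι → ℝ → Plane}
    {S : Set Plane} (hS : MeasurableSet S) (h : ∀ k, distribution I (φ k) S = 0) :
    mixture I α φ S = 0 := by
  rw [mixture, Measure.sum_apply _ hS]
  simp [h]

/-- By `‖p‖ ≤ N p + C`, the `L¹` norm of each function is bounded through its average alone,
uniformly in `k` because the averages are bounded. -/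
theorem integrable_mixture {ι : Type*} (hI : IsInterval I)
    {N : Plane →L[ℝ] ℝ} {C : ℝ} (hN : ∀ p ∈ closure Ω₀, ‖p‖ ≤ N p + C)
    {α : ι → ℝ} (hα : ∀ k, 0 ≤ α k) (hα1 : HasSum α 1) {φ : ι → ℝ → Plane}
    (hφ : ∀ k, MemA Ω₀ Ω₁ I (φ k)) {R : ℝ} (hR : ∀ k, ‖⨍ t in I, φ k t‖ ≤ R) :
    Integrable (fun p => p) (mixture I α φ) := by
  refine ⟨aestronglyMeasurable_id, ?_⟩
  rw [HasFiniteIntegral, mixture, lintegral_sum_measure]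
  have := hI.isProbabilityMeasure_cond
  have hk : ∀ k, ∫⁻ p, ‖p‖ₑ ∂(ENNReal.ofReal (α k) • distribution I (φ k)) ≤
      ENNReal.ofReal (α k) * ENNReal.ofReal (‖N‖ * R + C) := by
    intro k
    have hi := (hφ k).integrable_cond hI
    rw [lintegral_smul_measure, smul_eq_mul]
    gcongr
    rw [distribution, lintegral_map' (by fun_prop) hi.aemeasurable,
      ← ofReal_integral_norm_eq_lintegral_enorm hi]
    refine ENNReal.ofReal_le_ofReal ?_
    calc ∫ t, ‖φ k t‖ ∂(ProbabilityTheory.cond volume I)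
        ≤ ∫ t, (N (φ k t) + C) ∂(ProbabilityTheory.cond volume I) := by
          refine integral_mono_ae hi.norm ((N.integrable_comp hi).add (integrable_const C)) ?_
          exact ae_cond_of_forall_mem hI fun t ht =>
            hN _ (frontier_subset_closure ((hφ k).mem_frontier t ht))
      _ = N (⨍ t in I, φ k t) + C := by
          rw [integral_add (N.integrable_comp hi) (integrable_const C), N.integral_comp_comm hi,
            setAverage_eq_integral_cond, integral_const]
          simp
      _ ≤ ‖N‖ * R + C := by
          gcongr
          refine (le_abs_self _).trans ((N.le_opNorm _).trans ?_)
          gcongr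
          exact hR k
  refine (ENNReal.tsum_le_tsum hk).trans_lt ?_
  rw [ENNReal.tsum_mul_right, ← ENNReal.ofReal_tsum_of_nonneg hα hα1.summable]
  exact ENNReal.mul_lt_top ENNReal.ofReal_lt_top ENNReal.ofReal_lt_top

theorem domain_subset (hΩ : IsPair Ω₀ Ω₁) {p : Plane} (hp : p ∈ domain Ω₀ Ω₁) :
    p ∈ closure Ω₀ ∧ p ∉ Ω₁ := by
  refine ⟨closure_mono sdiff_subset hp, fun h => ?_⟩
  obtain ⟨q, hq, hq'⟩ := mem_closure_iff.1 hp Ω₁ hΩ.isOpen_inner h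
  exact hq'.2 hq

/-- A mixture of the distributions of functions of class `A_Ω` is the distribution of a function
of class `A_Ω`. -/
theorem exists_memA_mixture (hΩ : IsPair Ω₀ Ω₁) (h₀ : NoSegments (frontier Ω₀))
    {X Y : Plane →L[ℝ] ℝ} {e : Plane} (hX : IsVertical Ω₀ Ω₁ X e) (hY : Y e = 1)
    {N : Plane →L[ℝ] ℝ} {c : ℝ} (hN : ∀ p ∈ closure Ω₀, ‖p‖ ≤ N p + c) (hI : IsInterval I)
    {ι : Type*} [Countable ι] {α : ι → ℝ} (hα : ∀ k, 0 ≤ α k) (hα1 : HasSum α 1)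
    {φ : ι → ℝ → Plane} (hφ : ∀ k, MemA Ω₀ Ω₁ I (φ k))
    (hC : convexHull ℝ (range fun k => ⨍ t in I, φ k t) ⊆ domain Ω₀ Ω₁)
    (hbd : Bornology.IsBounded (convexHull ℝ (range fun k => ⨍ t in I, φ k t))) :
    ∃ ψ : ℝ → Plane, MemA Ω₀ Ω₁ I ψ ∧ distribution I ψ = mixture I α φ := by
  set C := convexHull ℝ (range fun k => ⨍ t in I, φ k t) with hCdef
  have hxC : ∀ k, ⨍ t in I, φ k t ∈ C := fun k => subset_convexHull ℝ _ ⟨k, rfl⟩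
  obtain ⟨R, hR⟩ := hbd.exists_norm_le
  have hint := integrable_mixture hI hN hα hα1 hφ fun k => hR _ (hxC k)
  have hprob := isProbabilityMeasure_mixture hI hα hα1 fun k => (hφ k).integrable
  have hmean := hasSum_integral_mixture hI hα (fun k => (hφ k).integrable) stronglyMeasurable_id
    hint
  obtain ⟨a, b, hab, hI1, hI2⟩ := hI.exists_Ioo
  have key : ∀ Z : Plane →L[ℝ] ℝ, IsVertical Ω₀ Ω₁ Z e → ∀ w ∈ Ω₁, ∀ L : Plane →L[ℝ] ℝ, 0 < L e →
      Z (∫ p, p ∂(mixture I α φ)) ≤ Z w → ∫ p, wedge Z L w p ∂(mixture I α φ) ≤ 0 := by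
    intro Z hZ w hw L hL hm
    have hN1 : ∀ p ∈ Ω₁ᶜ, Z p = Z w → L p ≤ L w := fun p hp hpw =>
      le_of_eq_of_notMem hZ.exists_smul_eq hZ.inner_mem hL hw hp hpw
    have hCc : closure C ⊆ Ω₁ᶜ := closure_minimal (fun p hp => (domain_subset hΩ (hC hp)).2)
      hΩ.isOpen_inner.isClosed_compl
    have hwi := integrable_wedge Z L w hint
    have hs := hasSum_integral_mixture hI hα (fun k => (hφ k).integrable)
      (measurable_wedge Z L w).stronglyMeasurable hwi
    have hle : ∀ k, ⨍ t in I, wedge Z L w (φ k t) ≤ wedge Z L w (⨍ t in I, φ k t) := by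
      intro k
      rw [setAverage_eq_of_between hI1 hI2, setAverage_eq_of_between hI1 hI2]
      refine setAverage_wedge_le Z L w hab ((hφ k).integrable.mono_set hI1) hN1
        (fun t ht => notMem_inner_of_mem_frontier hΩ ((hφ k).mem_frontier t (hI1 ht)))
        fun p q hp hpq hq => (hφ k).average_notMem _ (isInterval_Ioo hpq)
          ((Ioo_subset_Ioo hp hq).trans hI1)
    have hsum : Summable fun k => α k * wedge Z L w (⨍ t in I, φ k t) := by
      refine Summable.of_norm_bounded (g := fun k => α k * (‖L‖ * (R + ‖w‖)))
        (hα1.summable.mul_right _) fun k => ?_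
      rw [norm_mul, Real.norm_of_nonneg (hα k)]
      refine mul_le_mul_of_nonneg_left ((abs_wedge_le Z L w _).trans ((L.le_opNorm _).trans ?_))
        (hα k)
      gcongr
      exact (norm_sub_le _ _).trans (by gcongr; exact hR _ (hxC k))
    refine (hasSum_le (fun k => ?_) hs hsum.hasSum).trans (tsum_wedge_nonpos
      (convex_convexHull ℝ _) (fun p hp => hN1 p (hCc hp)) hα hα1 hxC hmean hm hsum.hasSum)
    exact mul_le_mul_of_nonneg_left (hle k) (hα k)
  refine exists_memA_of_wedge hΩ h₀ hX hY hI (mixture I α φ) ?_ hint (key X hX) ?_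
  · exact mixture_apply_eq_zero isClosed_frontier.measurableSet.compl fun k =>
      distribution_apply_compl_eq_zero hI (hφ k).integrable isClosed_frontier.measurableSet
        (hφ k).mem_frontier
  · intro w hw L hL hm
    refine key (-X) hX.neg w hw L hL ?_
    simpa using hm

/-! ### Competitors with a prescribed average -/

/-- A step function with values `A` and `B`: all its averages stay on the segment, which misses
`Ω₁`. -/
theorem exists_memAb_two_values (hI : IsInterval I) {A B : Plane} (hA : A ∈ frontier Ω₀)
    (hB : B ∈ frontier Ω₀) {θ : ℝ} (h0 : 0 ≤ θ) (h1 : θ ≤ 1) (hd : Disjoint (segment ℝ A B) Ω₁) :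
    ∃ φ : ℝ → Plane, MemAb Ω₀ Ω₁ I φ ∧ ⨍ t in I, φ t = θ • A + (1 - θ) • B := by
  obtain ⟨a, b, hab, hI1, hI2⟩ := hI.exists_Ioo
  set c := a + θ * (b - a)
  have hcb : c ≤ b := by simp only [c]; nlinarith
  set φ : ℝ → Plane := fun t => (Iio c).indicator (fun _ => A - B) t + B with hφ
  have hval : ∀ t, φ t = A ∨ φ t = B := by
    intro t
    by_cases ht : t ∈ Iio c
    · left; simp only [hφ, indicator_of_mem ht, sub_add_cancel]
    · right; simp only [hφ, indicator_of_notMem ht, zero_add]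
  have hint : ∀ J : Set ℝ, volume J ≠ ⊤ → IntegrableOn φ J := fun J hJ =>
    ((integrableOn_const (C := A - B) hJ).indicator measurableSet_Iio).add (integrableOn_const hJ)
  have hfin : ∀ J : Set ℝ, IsInterval J → volume J ≠ ⊤ ∧ volume J ≠ 0 := by
    intro J hJ
    obtain ⟨p, q, hpq, hJ1, hJ2⟩ := hJ.exists_Ioo
    refine ⟨((measure_mono hJ2).trans_lt measure_Icc_lt_top).ne, fun h => ?_⟩
    have := measure_mono_null hJ1 h
    rw [Real.volume_Ioo, ENNReal.ofReal_eq_zero] at this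
    linarith
  have hseg : ∀ t, φ t ∈ segment ℝ A B := fun t => by
    rcases hval t with h | h <;> rw [h]
    · exact left_mem_segment ℝ A B
    · exact right_mem_segment ℝ A B
  have hsc : IsClosed (segment ℝ A B) := by
    rw [segment_eq_image]
    exact (isCompact_Icc.image (by fun_prop)).isClosed
  refine ⟨φ, ⟨⟨hint I (hfin I hI).1, fun t _ => ?_, fun J hJ _ => ?_⟩, ?_⟩, ?_⟩
  · rcases hval t with h | h <;> rw [h] <;> assumption
  · refine Set.disjoint_left.1 hd ?_
    exact (convex_segment A B).set_average_mem hsc (hfin J hJ).2 (hfin J hJ).1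
      (Filter.Eventually.of_forall hseg) (hint J (hfin J hJ).1)
  · refine (Set.toFinite {A, B}).isBounded.subset ?_
    rintro _ ⟨t, -, rfl⟩
    exact hval t
  · have hv : volume (Ioo a b) ≠ ⊤ := by rw [Real.volume_Ioo]; exact ENNReal.ofReal_ne_top
    have hca : 0 ≤ c - a := by simp only [c]; nlinarith
    rw [setAverage_eq_of_between hI1 hI2, setAverage_Ioo hab, hφ,
      integral_add ((integrableOn_const (C := A - B) hv).indicator measurableSet_Iio)
        (integrableOn_const (C := B) hv),
      setIntegral_indicator measurableSet_Iio, setIntegral_const, setIntegral_const,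
      Ioo_inter_Iio, min_eq_right hcb, Measure.real, Measure.real, Real.volume_Ioo,
      Real.volume_Ioo, ENNReal.toReal_ofReal hca, ENNReal.toReal_ofReal (sub_pos.2 hab).le,
      smul_add, smul_smul, smul_smul, inv_mul_cancel₀ (sub_pos.2 hab).ne']
    have : (b - a)⁻¹ * (c - a) = θ := by
      have := (sub_pos.2 hab).ne'
      simp only [c]; field_simp; ring
    rw [this]
    module

theorem exists_memAb_average_eq (hΩ : IsPair Ω₀ Ω₁) (h₁ : NoSegments (frontier Ω₁))
    (hray : RayCondition Ω₀ Ω₁) {N : Plane →L[ℝ] ℝ} {C : ℝ}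
    (hN : ∀ p ∈ closure Ω₀, ‖p‖ ≤ N p + C) (hI : IsInterval I) {x : Plane}
    (hx : x ∈ domain Ω₀ Ω₁) : ∃ φ : ℝ → Plane, MemAb Ω₀ Ω₁ I φ ∧ ⨍ t in I, φ t = x := by
  obtain ⟨hxc, hx₁⟩ := domain_subset hΩ hx
  by_cases hx₀ : x ∈ Ω₀
  · obtain ⟨A, hA, B, hB, θ, h0, h1, hθ, hd⟩ := exists_chord hΩ h₁ hray hN hx₀ hx₁
    rw [← hθ]
    exact exists_memAb_two_values hI hA hB h0.le h1.le hd
  · have hxS : x ∈ frontier Ω₀ := (mem_frontier_of_isOpen hΩ.isOpen_outer).2 ⟨hxc, hx₀⟩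
    obtain ⟨φ, hφ, hav⟩ := exists_memAb_two_values (Ω₁ := Ω₁) hI hxS hxS zero_le_one le_rfl
      (by rw [segment_same]; exact disjoint_singleton_left.2 hx₁)
    exact ⟨φ, hφ, by rw [hav]; simp⟩

/-! ### Local concavity from mixtures -/

theorem measurable_indicator_of_domRestrict {S : Set Plane} (hS : MeasurableSet S) {f : Plane → ℝ}
    (hf : Measurable (S.domRestrict f)) : Measurable (S.indicator f) := by
  have h1 : Measurable (S.domRestrict (S.indicator f)) := by
    have : S.domRestrict (S.indicator f) = S.domRestrict f := by
      funext s
      exact indicator_of_mem s.2 f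
    rwa [this]
  have h2 : Measurable (Sᶜ.domRestrict (S.indicator f)) := by
    have : Sᶜ.domRestrict (S.indicator f) = fun _ => 0 := by
      funext s
      exact indicator_of_notMem s.2 f
    rw [this]
    exact measurable_const
  exact measurable_of_restrict_of_restrict_compl hS h1 h2

theorem lintegral_comp_eq_lintegral_distribution (hI : IsInterval I) {f : Plane → ℝ}
    (hf : Measurable ((frontier Ω₀).domRestrict f)) {φ : ℝ → Plane} (hφ : MemA Ω₀ Ω₁ I φ)
    {G : ℝ → ENNReal} (hG : Measurable G) :
    ∫⁻ t, G (f (φ t)) ∂(ProbabilityTheory.cond volume I) =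
      ∫⁻ p, G ((frontier Ω₀).indicator f p) ∂(distribution I φ) := by
  have hF := measurable_indicator_of_domRestrict isClosed_frontier.measurableSet hf
  have hGF : Measurable fun p => G ((frontier Ω₀).indicator f p) := hG.comp hF
  rw [distribution, lintegral_map' hGF.aemeasurable (hφ.integrable_cond hI).aemeasurable]
  refine lintegral_congr_ae (ae_cond_of_forall_mem hI fun t ht => ?_)
  simp only [indicator_of_mem (hφ.mem_frontier t ht)]

theorem setAverage_of_distribution_eq (hI : IsInterval I) {φ₁ φ₂ ψ : ℝ → Plane}
    (h₁ : IntegrableOn φ₁ I) (h₂ : IntegrableOn φ₂ I) (hψ : IntegrableOn ψ I) {a b : ℝ}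
    (ha : 0 ≤ a) (hb : 0 ≤ b) (h : distribution I ψ =
      ENNReal.ofReal a • distribution I φ₁ + ENNReal.ofReal b • distribution I φ₂) :
    ⨍ t in I, ψ t = a • (⨍ t in I, φ₁ t) + b • ⨍ t in I, φ₂ t := by
  have hid : ∀ {φ : ℝ → Plane}, IntegrableOn φ I → Integrable (fun p : Plane => p)
      (distribution I φ) := by
    intro φ hφ
    have hi := IntegrableOn.integrable_cond hI hφ
    rw [distribution, integrable_map_measure (by fun_prop) hi.aemeasurable]
    exact hi
  have key : ∀ φ : ℝ → Plane, IntegrableOn φ I →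
      ∫ p, p ∂(distribution I φ) = ⨍ t in I, φ t := fun φ hφ =>
    integral_distribution hI hφ (g := fun p => p) stronglyMeasurable_id
  rw [← key ψ hψ, h, integral_add_measure ((hid h₁).smul_measure ENNReal.ofReal_ne_top)
    ((hid h₂).smul_measure ENNReal.ofReal_ne_top), integral_smul_measure, integral_smul_measure,
    key φ₁ h₁, key φ₂ h₂, ENNReal.toReal_ofReal ha, ENNReal.toReal_ofReal hb]

theorem coe_ofReal_mul (a : ℝ) (ha : 0 ≤ a) (P : ENNReal) :
    ((ENNReal.ofReal a * P : ENNReal) : EReal) = (a : EReal) * (P : EReal) := by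
  rw [EReal.coe_ennreal_mul, EReal.coe_ennreal_ofReal, max_eq_left ha]

/-- Finiteness of the negative parts rules out `∞ - ∞`, which makes `extAverage` linear under
mixing. -/
theorem sub_ereal_combo {a b : ℝ} (ha : 0 < a) (hb : 0 < b) {P₁ P₂ N₁ N₂ : ENNReal}
    (h₁ : N₁ ≠ ⊤) (h₂ : N₂ ≠ ⊤) :
    (a : EReal) * ((P₁ : EReal) - N₁) + (b : EReal) * ((P₂ : EReal) - N₂) =
      ((ENNReal.ofReal a * P₁ + ENNReal.ofReal b * P₂ : ENNReal) : EReal) -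
        ((ENNReal.ofReal a * N₁ + ENNReal.ofReal b * N₂ : ENNReal) : EReal) := by
  have coe_nn : ∀ {N : ENNReal}, N ≠ ⊤ → ∃ n : ℝ, (N : EReal) = n := fun {N} hN =>
    ⟨N.toReal, by lift N to NNReal using hN; rfl⟩
  obtain ⟨n₁, hn₁⟩ := coe_nn h₁
  obtain ⟨n₂, hn₂⟩ := coe_nn h₂
  rw [EReal.coe_ennreal_add, EReal.coe_ennreal_add, coe_ofReal_mul a ha.le, coe_ofReal_mul b hb.le,
    coe_ofReal_mul a ha.le, coe_ofReal_mul b hb.le, hn₁, hn₂]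
  have hN : (a : EReal) * (n₁ : EReal) + (b : EReal) * (n₂ : EReal) =
      ((a * n₁ + b * n₂ : ℝ) : EReal) := by
    push_cast; rfl
  by_cases hP₁ : P₁ = ⊤ <;> by_cases hP₂ : P₂ = ⊤
  · subst hP₁ hP₂
    rw [hN]
    simp only [EReal.coe_ennreal_top, EReal.top_sub_coe, EReal.coe_mul_top_of_pos ha,
      EReal.coe_mul_top_of_pos hb, EReal.top_add_top]
  · obtain ⟨p₂, hp₂⟩ := coe_nn hP₂
    subst hP₁
    rw [hp₂, hN]
    simp only [EReal.coe_ennreal_top, EReal.top_sub_coe, EReal.coe_mul_top_of_pos ha,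
      ← EReal.coe_mul, ← EReal.coe_sub, EReal.top_add_coe]
  · obtain ⟨p₁, hp₁⟩ := coe_nn hP₁
    subst hP₂
    rw [hp₁, hN]
    simp only [EReal.coe_ennreal_top, EReal.top_sub_coe, EReal.coe_mul_top_of_pos hb,
      ← EReal.coe_mul, ← EReal.coe_sub, EReal.coe_add_top]
  · obtain ⟨p₁, hp₁⟩ := coe_nn hP₁
    obtain ⟨p₂, hp₂⟩ := coe_nn hP₂
    rw [hp₁, hp₂]
    norm_cast
    ring

/-- If `C` is real, the absence of `⊥` forces all elements of both sets to be real, and the suprema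
are taken one at a time. -/
theorem combo_sSup_le {A B : Set EReal} {a b : ℝ} (ha : 0 < a) (hb : 0 < b) {C : EReal}
    (hA : A.Nonempty) (hB : B.Nonempty) (hA' : ∀ s ∈ A, s ≠ ⊥) (hB' : ∀ s ∈ B, s ≠ ⊥)
    (h : ∀ s ∈ A, ∀ t ∈ B, (a : EReal) * s + (b : EReal) * t ≤ C) :
    (a : EReal) * sSup A + (b : EReal) * sSup B ≤ C := by
  obtain ⟨s₀, hs₀⟩ := hA
  obtain ⟨t₀, ht₀⟩ := hB
  have hmul : ∀ {c : ℝ}, 0 < c → ∀ {s : EReal}, s ≠ ⊥ → (c : EReal) * s ≠ ⊥ := by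
    intro c hc s hs
    induction s with
    | bot => exact absurd rfl hs
    | coe x => rw [← EReal.coe_mul]; exact EReal.coe_ne_bot _
    | top => rw [EReal.coe_mul_top_of_pos hc]; exact top_ne_bot
  induction C with
  | top => exact le_top
  | bot =>
    exact absurd (le_bot_iff.1 (h s₀ hs₀ t₀ ht₀)) (by
      rw [EReal.add_eq_bot_iff, not_or]
      exact ⟨hmul ha (hA' _ hs₀), hmul hb (hB' _ ht₀)⟩)
  | coe c =>
    have hAr : ∀ s ∈ A, ∃ x : ℝ, s = x := by
      intro s hs
      have hle := h s hs t₀ ht₀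
      have hb0 := hmul hb (hB' _ ht₀)
      have hs' := hA' s hs
      induction s with
      | bot => exact absurd rfl hs'
      | coe x => exact ⟨x, rfl⟩
      | top =>
        rw [EReal.coe_mul_top_of_pos ha, EReal.top_add_of_ne_bot hb0, top_le_iff] at hle
        exact absurd hle (EReal.coe_ne_top c)
    have hBr : ∀ t ∈ B, ∃ y : ℝ, t = y := by
      intro t ht
      have hle := h s₀ hs₀ t ht
      have ha0 := hmul ha (hA' _ hs₀)
      have ht' := hB' t ht
      induction t with
      | bot => exact absurd rfl ht'
      | coe x => exact ⟨x, rfl⟩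
      | top =>
        rw [EReal.coe_mul_top_of_pos hb, EReal.add_top_of_ne_bot ha0, top_le_iff] at hle
        exact absurd hle (EReal.coe_ne_top c)
    have hreal : ∀ x y : ℝ, (x : EReal) ∈ A → (y : EReal) ∈ B → a * x + b * y ≤ c := by
      intro x y hx hy
      exact_mod_cast h _ hx _ hy
    obtain ⟨x₀, rfl⟩ := hAr s₀ hs₀
    obtain ⟨y₀, rfl⟩ := hBr t₀ ht₀
    have hAle : ∀ y : ℝ, (y : EReal) ∈ B → sSup A ≤ (((c - b * y) / a : ℝ) : EReal) := by
      intro y hy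
      refine sSup_le fun s hs => ?_
      obtain ⟨x, rfl⟩ := hAr s hs
      rw [EReal.coe_le_coe_iff, le_div_iff₀ ha]
      linarith [hreal x y hs hy]
    obtain ⟨X, hX⟩ : ∃ X : ℝ, sSup A = X := by
      have h1 := hAle y₀ ht₀
      have h2 := le_sSup hs₀
      generalize sSup A = S at h1 h2
      induction S with
      | bot => exact absurd (le_bot_iff.1 h2) (EReal.coe_ne_bot _)
      | coe x => exact ⟨x, rfl⟩
      | top => exact absurd (top_le_iff.1 h1) (EReal.coe_ne_top _)
    have hBle : sSup B ≤ (((c - a * X) / b : ℝ) : EReal) := by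
      refine sSup_le fun t ht => ?_
      obtain ⟨y, rfl⟩ := hBr t ht
      have := hAle y ht
      rw [hX, EReal.coe_le_coe_iff, le_div_iff₀ ha] at this
      rw [EReal.coe_le_coe_iff, le_div_iff₀ hb]
      linarith
    obtain ⟨Z, hZ⟩ : ∃ Z : ℝ, sSup B = Z := by
      have h2 := le_sSup ht₀
      generalize sSup B = S at hBle h2
      induction S with
      | bot => exact absurd (le_bot_iff.1 h2) (EReal.coe_ne_bot _)
      | coe x => exact ⟨x, rfl⟩
      | top => exact absurd (top_le_iff.1 hBle) (EReal.coe_ne_top _)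
    rw [hZ, EReal.coe_le_coe_iff, le_div_iff₀ hb] at hBle
    rw [hX, hZ]
    norm_cast
    linarith

/-- A Bellman function over a class of functions that is closed under mixtures of two
distributions is locally concave. -/
theorem locallyConcave_of_mixture (hI : IsInterval I) {P : (ℝ → Plane) → Prop}
    (hP : ∀ φ, P φ → MemA Ω₀ Ω₁ I φ)
    (hex : ∀ x ∈ domain Ω₀ Ω₁, ∃ φ, P φ ∧ ⨍ t in I, φ t = x)
    (hmix : ∀ φ₁ φ₂, P φ₁ → P φ₂ → ∀ a b : ℝ, 0 ≤ a → 0 ≤ b → a + b = 1 →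
      segment ℝ (⨍ t in I, φ₁ t) (⨍ t in I, φ₂ t) ⊆ domain Ω₀ Ω₁ →
      ∃ ψ, P ψ ∧ distribution I ψ =
        ENNReal.ofReal a • distribution I φ₁ + ENNReal.ofReal b • distribution I φ₂)
    {f : Plane → ℝ} (hf : Measurable ((frontier Ω₀).domRestrict f))
    (hfb : ∀ φ, P φ → BddBelow (f '' (φ '' I))) :
    LocallyConcave (domain Ω₀ Ω₁) fun x => sSup {s : EReal | ∃ φ : ℝ → Plane, P φ ∧
      (⨍ t in I, φ t) = x ∧ s = extAverage I (fun t => f (φ t))} := by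
  have hprob := hI.isProbabilityMeasure_cond
  have hfin : ∀ φ, P φ →
      ∫⁻ t, ENNReal.ofReal (-f (φ t)) ∂(ProbabilityTheory.cond volume I) ≠ ⊤ := by
    intro φ hφ
    obtain ⟨m, hm⟩ := hfb φ hφ
    refine ne_top_of_le_ne_top (b := ENNReal.ofReal (-m)) ENNReal.ofReal_ne_top ?_
    calc ∫⁻ t, ENNReal.ofReal (-f (φ t)) ∂(ProbabilityTheory.cond volume I)
        ≤ ∫⁻ _, ENNReal.ofReal (-m) ∂(ProbabilityTheory.cond volume I) := by
          refine lintegral_mono_ae (ae_cond_of_forall_mem hI fun t ht => ?_)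
          exact ENNReal.ofReal_le_ofReal
            (neg_le_neg (hm (mem_image_of_mem f (mem_image_of_mem φ ht))))
      _ = ENNReal.ofReal (-m) := by simp
  have hbot : ∀ φ, P φ → extAverage I (fun t => f (φ t)) ≠ ⊥ := by
    intro φ hφ
    rw [extAverage, sub_eq_add_neg, Ne, EReal.add_eq_bot_iff, not_or]
    refine ⟨EReal.coe_ennreal_ne_bot _, ?_⟩
    rw [EReal.neg_eq_bot_iff, EReal.coe_ennreal_eq_top_iff]
    exact hfin φ hφ
  refine ⟨fun x hx h => ?_, fun x y hxy a b ha hb hab => ?_⟩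
  · obtain ⟨φ, hφ, hav⟩ := hex x hx
    exact hbot φ hφ (sSup_eq_bot.1 h _ ⟨φ, hφ, hav, rfl⟩)
  · rcases ha.eq_or_lt with rfl | ha0
    · obtain rfl : b = 1 := by linarith
      simp
    rcases hb.eq_or_lt with rfl | hb0
    · obtain rfl : a = 1 := by linarith
      simp
    obtain ⟨φx, hφx, hax⟩ := hex x (hxy (left_mem_segment ℝ x y))
    obtain ⟨φy, hφy, hay⟩ := hex y (hxy (right_mem_segment ℝ x y))
    refine combo_sSup_le ha0 hb0 ⟨_, φx, hφx, hax, rfl⟩ ⟨_, φy, hφy, hay, rfl⟩ ?_ ?_ ?_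
    · rintro s ⟨φ, hφ, -, rfl⟩
      exact hbot φ hφ
    · rintro s ⟨φ, hφ, -, rfl⟩
      exact hbot φ hφ
    · rintro s ⟨φ₁, h₁, hx, rfl⟩ t ⟨φ₂, h₂, hy, rfl⟩
      obtain ⟨ψ, hψ, hd⟩ := hmix φ₁ φ₂ h₁ h₂ a b ha hb hab (by rw [hx, hy]; exact hxy)
      refine le_sSup ⟨ψ, hψ, ?_, ?_⟩
      · rw [setAverage_of_distribution_eq hI (hP _ h₁).integrable (hP _ h₂).integrable
          (hP _ hψ).integrable ha hb hd, hx, hy]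
      · have hlin : ∀ {G : ℝ → ENNReal}, Measurable G →
            ∫⁻ t, G (f (ψ t)) ∂(ProbabilityTheory.cond volume I) =
              ENNReal.ofReal a * ∫⁻ t, G (f (φ₁ t)) ∂(ProbabilityTheory.cond volume I) +
              ENNReal.ofReal b * ∫⁻ t, G (f (φ₂ t)) ∂(ProbabilityTheory.cond volume I) := by
          intro G hG
          rw [lintegral_comp_eq_lintegral_distribution hI hf (hP _ hψ) hG,
            lintegral_comp_eq_lintegral_distribution hI hf (hP _ h₁) hG,
            lintegral_comp_eq_lintegral_distribution hI hf (hP _ h₂) hG, hd,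
            lintegral_add_measure, lintegral_smul_measure, lintegral_smul_measure, smul_eq_mul,
            smul_eq_mul]
        have hneg : Measurable fun x : ℝ => ENNReal.ofReal (-x) := by fun_prop
        simp only [extAverage]
        rw [hlin ENNReal.measurable_ofReal, hlin hneg]
        exact sub_ereal_combo ha0 hb0 (hfin _ h₁) (hfin _ h₂)

theorem bddBelow_image_of_isCompact {S K : Set Plane} (hK : IsCompact K) (hKS : K ⊆ S)
    {f : Plane → ℝ} (hf : LocallyBddBelowOn S f) : BddBelow (f '' K) := by
  refine hK.induction_on (p := fun s => BddBelow (f '' s)) (by simp)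
    (fun s t hst ht => ht.mono (image_mono hst)) (fun s t hs ht => ?_) fun x hx => ?_
  · rw [image_union]
    exact hs.union ht
  · obtain ⟨U, hU, hb⟩ := hf x (hKS hx)
    exact ⟨U, nhdsWithin_mono x hKS hU, hb⟩

end Class

end Bellman

/-! ### The theorem -/

theorem mainTheorem7 (Ω₀ Ω₁ : Set Bellman.Plane) (hΩ : Bellman.IsPair Ω₀ Ω₁)
    (h₀ : Bellman.NoSegments (frontier Ω₀)) (h₁ : Bellman.NoSegments (frontier Ω₁))
    (hray : Bellman.RayCondition Ω₀ Ω₁) (I : Set ℝ) (hI : Bellman.IsInterval I) :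
    (∀ (ι : Type) [Countable ι] (φ : ι → ℝ → Bellman.Plane) (α : ι → ℝ),
      (∀ k, Bellman.MemA Ω₀ Ω₁ I (φ k)) →
      convexHull ℝ (Set.range fun k => ⨍ t in I, φ k t) ⊆ Bellman.domain Ω₀ Ω₁ →
      Bornology.IsBounded (convexHull ℝ (Set.range fun k => ⨍ t in I, φ k t)) →
      (∀ k, 0 ≤ α k) → HasSum α 1 →
      ∃ ψ : ℝ → Bellman.Plane, Bellman.MemA Ω₀ Ω₁ I ψ ∧
        Bellman.distribution I ψ =
          Measure.sum fun k => ENNReal.ofReal (α k) • Bellman.distribution I (φ k)) ∧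
    (∀ f : Bellman.Plane → ℝ, Measurable ((frontier Ω₀).domRestrict f) →
      BddBelow (f '' frontier Ω₀) →
      Bellman.LocallyConcave (Bellman.domain Ω₀ Ω₁) (Bellman.bellman Ω₀ Ω₁ I f)) ∧
    (∀ f : Bellman.Plane → ℝ, Measurable ((frontier Ω₀).domRestrict f) →
      Bellman.LocallyBddBelowOn (frontier Ω₀) f →
      Bellman.LocallyConcave (Bellman.domain Ω₀ Ω₁) (Bellman.bellmanB Ω₀ Ω₁ I f)) := by
  obtain ⟨X, Y, e, hX, hY⟩ := Bellman.exists_isVertical hΩ hray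
  have he : e ≠ 0 := by
    rintro rfl
    simp at hY
  obtain ⟨N, C, hN⟩ := Bellman.exists_coercive hΩ h₀ hX he
  have part1 : ∀ (ι : Type) [Countable ι] (φ : ι → ℝ → Bellman.Plane) (α : ι → ℝ),
      (∀ k, Bellman.MemA Ω₀ Ω₁ I (φ k)) →
      convexHull ℝ (Set.range fun k => ⨍ t in I, φ k t) ⊆ Bellman.domain Ω₀ Ω₁ →
      Bornology.IsBounded (convexHull ℝ (Set.range fun k => ⨍ t in I, φ k t)) →
      (∀ k, 0 ≤ α k) → HasSum α 1 →
      ∃ ψ : ℝ → Bellman.Plane, Bellman.MemA Ω₀ Ω₁ I ψ ∧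
        Bellman.distribution I ψ =
          Measure.sum fun k => ENNReal.ofReal (α k) • Bellman.distribution I (φ k) :=
    fun ι _ φ α hφ hC hbd hα hα1 =>
      Bellman.exists_memA_mixture hΩ h₀ hX hY hN hI hα hα1 hφ hC hbd
  have two : ∀ φ₁ φ₂ : ℝ → Bellman.Plane, Bellman.MemA Ω₀ Ω₁ I φ₁ → Bellman.MemA Ω₀ Ω₁ I φ₂ →
      ∀ a b : ℝ, 0 ≤ a → 0 ≤ b → a + b = 1 →
      segment ℝ (⨍ t in I, φ₁ t) (⨍ t in I, φ₂ t) ⊆ Bellman.domain Ω₀ Ω₁ →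
      ∃ ψ, Bellman.MemA Ω₀ Ω₁ I ψ ∧ Bellman.distribution I ψ =
        ENNReal.ofReal a • Bellman.distribution I φ₁ +
          ENNReal.ofReal b • Bellman.distribution I φ₂ := by
    intro φ₁ φ₂ hφ₁ hφ₂ a b ha hb hab hseg
    have hr : range (fun k : Fin 2 => ⨍ t in I, (![φ₁, φ₂] k) t) =
        {⨍ t in I, φ₁ t, ⨍ t in I, φ₂ t} := by
      ext p
      simp [Fin.exists_fin_two, eq_comm]
    obtain ⟨ψ, hψ, hd⟩ := part1 (Fin 2) ![φ₁, φ₂] ![a, b]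
      (by intro k; fin_cases k <;> assumption)
      (by rwa [hr, convexHull_pair])
      (by rw [hr]; exact (isBounded_convexHull).2 (Set.toFinite _).isBounded)
      (by intro k; fin_cases k <;> assumption)
      (by rw [← hab]; simpa using hasSum_fintype (![a, b]))
    refine ⟨ψ, hψ, ?_⟩
    rw [hd, Measure.sum_fintype, Fin.sum_univ_two]
    rfl
  refine ⟨part1, fun f hf hb => ?_, fun f hf hb => ?_⟩
  · refine Bellman.locallyConcave_of_mixture hI (P := Bellman.MemA Ω₀ Ω₁ I) (fun φ h => h)
      (fun x hx => ?_) two hf fun φ hφ => ?_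
    · obtain ⟨φ, hφ, hav⟩ := Bellman.exists_memAb_average_eq hΩ h₁ hray hN hI hx
      exact ⟨φ, hφ.1, hav⟩
    · refine hb.mono (image_mono ?_)
      rintro _ ⟨t, ht, rfl⟩
      exact hφ.mem_frontier t ht
  · refine Bellman.locallyConcave_of_mixture hI (P := Bellman.MemAb Ω₀ Ω₁ I) (fun φ h => h.1)
      (fun x hx => Bellman.exists_memAb_average_eq hΩ h₁ hray hN hI hx) ?_ hf fun φ hφ => ?_
    · intro φ₁ φ₂ hφ₁ hφ₂ a b ha hb' hab hseg
      obtain ⟨ψ, hψ, hd⟩ := two φ₁ φ₂ hφ₁.1 hφ₂.1 a b ha hb' hab hseg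
      -- The distribution of `ψ` is carried by the bounded set `K`, so `ψ` is in `K` only almost
      -- everywhere. Resetting it on the exceptional null set makes it bounded and keeps both its
      -- distribution and its membership in the class.
      set K := closure (φ₁ '' I ∪ φ₂ '' I)
      have hKm : MeasurableSet K := isClosed_closure.measurableSet
      have hKb : Bornology.IsBounded K := (hφ₁.2.union hφ₂.2).closure
      have hm₁ : ∀ t ∈ I, φ₁ t ∈ K := fun t ht => subset_closure (Or.inl (mem_image_of_mem _ ht))
      have hm₂ : ∀ t ∈ I, φ₂ t ∈ K := fun t ht => subset_closure (Or.inr (mem_image_of_mem _ ht))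
      obtain ⟨t₀, ht₀⟩ := hI.nontrivial.nonempty
      classical
      set ψ' : ℝ → Bellman.Plane := fun t => if ψ t ∈ K then ψ t else φ₁ t₀ with hψ'
      have hψm := (hψ.integrable_cond hI).aemeasurable
      have hae : ψ =ᵐ[ProbabilityTheory.cond volume I] ψ' := by
        have h0 : Bellman.distribution I ψ Kᶜ = 0 := by
          rw [hd]
          simp [Bellman.distribution_apply_compl_eq_zero hI hφ₁.1.integrable hKm hm₁,
            Bellman.distribution_apply_compl_eq_zero hI hφ₂.1.integrable hKm hm₂]
        rw [Bellman.distribution, Measure.map_apply_of_aemeasurable hψm hKm.compl] at h0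
        have h1 : ∀ᵐ t ∂(ProbabilityTheory.cond volume I), ψ t ∈ K := h0
        filter_upwards [h1] with t ht
        simp only [hψ', if_pos ht]
      refine ⟨ψ', ⟨hψ.congr hI (fun t ht => ?_) hae, hKb.subset ?_⟩, ?_⟩
      · simp only [hψ']
        split_ifs
        · exact hψ.mem_frontier t ht
        · exact hφ₁.1.mem_frontier t₀ ht₀
      · rintro _ ⟨t, -, rfl⟩
        simp only [hψ']
        split_ifs with h
        · exact h
        · exact hm₁ t₀ ht₀
      · rw [← hd]
        exact (Measure.map_congr hae).symm
    · have hsub : closure (φ '' I) ⊆ frontier Ω₀ := closure_minimal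
        (by rintro _ ⟨t, ht, rfl⟩; exact hφ.1.mem_frontier t ht) isClosed_frontier
      exact (Bellman.bddBelow_image_of_isCompact
        (Metric.isCompact_of_isClosed_isBounded isClosed_closure hφ.2.closure) hsub hb).mono
        (image_mono subset_closure)
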